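/- Let $k$ be a field and $Q$ a finite quiver (oriented cycles allowed). Representations of $Q$ are families of $k$-spaces $(M_v)$ with a linear map $M_u\to M_v$ for each arrow $u\to v$, i.e. left $kQ$-modules; $\operatorname{Mod}(Q)$ is the category of the finitely generated ones. For a vertex $j$, $S_j$ is the simple representation at $j$ (all arrows zero), $P_j$ is the projective whose space at $v$ has as basis the paths from $j$ to $v$, and $I_j$ is the injective whose space at $v$ is the dual of the space spanned by the paths from $v$ to $j$. Let $i$ be a vertex such that $S_i$ is exceptional ($\operatorname{Hom}(S_i,S_i)=k\cdot\mathrm{id}\ne 0$, $\operatorname{Ext}^1(S_i,S_i)=0$) and Hom-finite ($\operatorname{Hom}$ and $\operatorname{Ext}^1$ between $S_i$ and $X$, in both directions, are finite-dimensional for every $X\in\operatorname{Mod}(Q)$). Let $S_i^\perp\subseteq\operatorname{Mod}(Q)$ be the full subcategory of all $N$ with $\operatorname{Hom}(S_i,N)=\operatorname{Ext}^1(S_i,N)=0$. Let $Q_i$ be the quiver with vertices $Q_V\setminus\{i\}$ whose arrows are the arrows of $Q$ not touching $i$, and one arrow $c_{ab}:u\to w$ for every pair of arrows $a:u\to i$,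 $b:i\to w$ of $Q$. Then the inclusion $S_i^\perp\to\operatorname{Mod}(Q)$ has a left adjoint, and there is an equivalence $\operatorname{Mod}(Q_i)\simeq S_i^\perp$ such that the following holds, where $\iota_i:\operatorname{Mod}(Q_i)\to\operatorname{Mod}(Q)$ is the equivalence followed by the inclusion, and $\pi_i:\operatorname{Mod}(Q)\to\operatorname{Mod}(Q_i)$ is any left adjoint of the inclusion followed by the inverse equivalence. 1. $\pi_i$ is isomorphic to the contraction at $i$: forget $M_i$, keep the maps of the arrows not touching $i$, and let $c_{ab}$ act as the composite $M_u\xrightarrow{a}M_i\xrightarrow{b}M_w$. (If $i$ is a source or a sink, there are no $c_{ab}$, and the arrows at $i$ are just forgotten.) 2. $\iota_i$ is isomorphic to the insertion at $i$: keep $N_v$ for $v\neq i$ and the maps of the arrows not touching $i$; put $\bigoplus_{b:i\to w}N_w$ (one summand for every arrow $b$ out of $i$) at $i$; an arrow $a:u\to i$ acts as the map whose component at the summand of $b$ is the map of $c_{ab}$; an arrow $b$ out of $i$ acts as the projection to its summand. 3. For vertices $j\ne i$ of $Q$, regarded as vertices of $Q_i$ (if $Q_V=\{1,\dots,n\}$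 and the vertices of $Q_i$ are renumbered in order, $j$ gets the number $j$ for $j<i$ and $j-1$ for $j>i$), with the modules on the right-hand sides being those of $Q_i$: $$\pi_i(S_j)\cong S_j,\qquad \pi_i(P_j)\cong P_j,\qquad \pi_i(I_j)\cong I_j\qquad(j\neq i),$$ $$\pi_i(S_i)=0,\qquad \pi_i(P_i)\cong\bigoplus_{w\ne i}a_{iw}P_w,\qquad \pi_i(I_i)\cong\bigoplus_{w\ne i}a_{wi}I_w,$$ where $a_{uv}$ is the number of arrows from $u$ to $v$ and $aX$ denotes $X^{\oplus a}$. The formulas for $\pi_i(I_j)$ hold whenever $I_j\in\operatorname{Mod}(Q)$, and they hold for all $I_j$ if $\pi_i$ is read as the contraction of arbitrary representations. -/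

import Mathlib

open CategoryTheory CategoryTheory.Limits

universe u

namespace QuiverContraction

/-! ## Representations of quivers -/

/-- Representations of the quiver `V` over `k`, i.e. left modules over the path algebra: a `k`-module
for every vertex and a linear map `M u ⟶ M v` for every arrow `u ⟶ v`
(extended multiplicatively to paths). -/
abbrev QRep (k : Type u) [Field k] (V : Type u) [Quiver.{u} V] : Type (u + 1) :=
  Paths V ⥤ ModuleCat.{u} k

/-! ## The spaces of the simple representations -/

section SimpleSpaces

variable (k : Type u) [Field k] {V : Type u}

/-- The space of `S_j` at `v`: the field if `v = j`, zero otherwise. -/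
def simpleObj {v j : V} : Decidable (v = j) → ModuleCat.{u} k
  | isTrue _ => ModuleCat.of k k
  | isFalse _ => ModuleCat.of k PUnit.{u + 1}

theorem simpleObj_cyclic {v j : V} (d : Decidable (v = j)) :
    ∃ x : simpleObj k d, ∀ W : Submodule k (simpleObj k d), x ∈ W → W = ⊤ := by
  cases d with
  | isTrue h =>
    exact ⟨(1 : k), fun W hW => (Ideal.eq_top_iff_one (W : Ideal k)).2 hW⟩
  | isFalse h =>
    refine ⟨PUnit.unit, fun W hW => ?_⟩
    rw [Submodule.eq_top_iff']
    intro y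
    exact hW

theorem simpleObj_eq_top {v j : V} (d : Decidable (v = j)) (h : v ≠ j)
    (W : Submodule k (simpleObj k d)) : W = ⊤ := by
  cases d with
  | isTrue h' => exact absurd h' h
  | isFalse h' =>
    rw [Submodule.eq_top_iff']
    intro y
    exact W.zero_mem

end SimpleSpaces

section Basic

variable (k : Type u) [Field k] {V : Type u} [Quiver.{u} V]

/-- The space of a representation at a vertex. -/
abbrev QRep.at {k : Type u} [Field k] (M : QRep k V) (v : V) : ModuleCat.{u} k :=
  M.obj ((Paths.of V).obj v)

/-- The linear map of a representation along an arrow. -/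
abbrev QRep.arrow {k : Type u} [Field k] (M : QRep k V) {v w : V} (a : v ⟶ w) : M.at v ⟶ M.at w :=
  M.map ((Paths.of V).map a)

/-- `M` is finitely generated (for finitely many vertices this is finite generation over the path
algebra): there are finitely many elements of the spaces of `M` such that
every family of subspaces that is stable under the arrows and contains them is everything. -/
def fg (V : Type u) [Quiver.{u} V] : ObjectProperty (QRep k V) := fun M =>
  ∃ s : Set (Σ v : V, M.at v), s.Finite ∧
    ∀ W : (v : V) → Submodule k (M.at v),
      (∀ (v w : V) (a : v ⟶ w) (x : M.at v), x ∈ W v → (M.arrow a).hom x ∈ W w) →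
      (∀ p ∈ s, p.2 ∈ W p.1) → ∀ v, W v = ⊤

/-- The category `Mod(Q)` of finitely generated left modules over the path algebra. -/
abbrev FGRep (V : Type u) [Quiver.{u} V] : Type (u + 1) := (fg k V).FullSubcategory

/-- A family of maps between the spaces of two representations that is compatible with the arrows
is a morphism of representations. -/
def homMk {k : Type u} [Field k] {M N : QRep k V} (app : (v : V) → (M.at v ⟶ N.at v))
    (h : ∀ {v w : V} (a : v ⟶ w), M.arrow a ≫ app w = app v ≫ N.arrow a) : M ⟶ N where
  app := app
  naturality := by
    have key : ∀ (app' : (v : Paths V) → (M.obj v ⟶ N.obj v)),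
        (∀ {v w : V} (a : v ⟶ w), M.map ((Paths.of V).map a) ≫ app' ((Paths.of V).obj w) =
          app' ((Paths.of V).obj v) ≫ N.map ((Paths.of V).map a)) →
        ∀ {v w : Paths V} (p : v ⟶ w), M.map p ≫ app' w = app' v ≫ N.map p := by
      intro app' h' v w p
      induction p using Paths.induction with
      | id => simp
      | comp p a ih =>
        rw [Functor.map_comp, Functor.map_comp, Category.assoc, h' a, ← Category.assoc, ih,
          Category.assoc]
    exact fun {v w} p => key app h p

/-- The simple representation `S_j`: the field at `j`, zero elsewhere, all arrows zero. -/
def simple [dec : DecidableEq V] (j : V) : QRep k V :=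
  Paths.lift
    { obj := fun v => simpleObj k (dec v j)
      map := fun _ => ModuleCat.ofHom 0 }

/-- The indecomposable projective `P_j`: at `v` the space with basis the paths from `j` to `v`. -/
noncomputable def proj (j : V) : QRep k V where
  obj v := ModuleCat.of k (((Paths.of V).obj j ⟶ v) →₀ k)
  map p := ModuleCat.ofHom (Finsupp.lmapDomain k k (fun q => q ≫ p))
  map_id v := by
    ext : 1
    simp only [Category.comp_id]
    exact Finsupp.lmapDomain_id k k
  map_comp p q := by
    ext : 1
    simp only [← Category.assoc]
    exact Finsupp.lmapDomain_comp k k (fun r => r ≫ p) (fun r => r ≫ q)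

/-- The indecomposable injective `I_j`: at `v` the dual of the space with basis the paths from `v`
to `j`, i.e. the `k`-valued functions on these paths. -/
noncomputable def inj (j : V) : QRep k V where
  obj v := ModuleCat.of k ((v ⟶ (Paths.of V).obj j) → k)
  map p := ModuleCat.ofHom (LinearMap.funLeft k k (fun q => p ≫ q))
  map_id v := by
    ext : 1
    simp only [Category.id_comp]
    exact LinearMap.ext (LinearMap.funLeft_id k k)
  map_comp p q := by
    ext : 1
    simp only [Category.assoc]
    exact LinearMap.funLeft_comp k k (fun r => p ≫ r) (fun r => q ≫ r)

theorem simple_fg [dec : DecidableEq V] (j : V) : fg k V (simple k j) := by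
  obtain ⟨x, hx⟩ := simpleObj_cyclic k (dec j j)
  refine ⟨{⟨j, x⟩}, Set.finite_singleton _, fun W _ hs v => ?_⟩
  by_cases h : v = j
  · subst h
    exact hx (W v) (hs _ rfl)
  · exact simpleObj_eq_top k (dec v j) h (W v)

theorem proj_fg (j : V) : fg k V (proj k j) := by
  refine ⟨{⟨j, Finsupp.single (𝟙 _) (1 : k)⟩}, Set.finite_singleton _, fun W hW hs => ?_⟩
  have key : ∀ (v : Paths V) (p : (Paths.of V).obj j ⟶ v),
      (Finsupp.single p (1 : k) : (proj k j).obj v) ∈ W v := by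
    intro v p
    refine Paths.induction_fixed_source
      (P := fun {v} p => (Finsupp.single p (1 : k) : (proj k j).obj v) ∈ W v) (hs _ rfl) ?_ p
    intro v w p a hp
    have := hW v w a _ hp
    have e : ((proj k j).arrow a).hom (Finsupp.single p (1 : k)) =
        Finsupp.single (p ≫ (Paths.of V).map a) (1 : k) :=
      Finsupp.mapDomain_single (M := k) (f := fun q => q ≫ (Paths.of V).map a)
    rw [e] at this
    exact this
  intro v
  rw [Submodule.eq_top_iff']
  intro x
  refine Finsupp.induction_linear (motive := fun x => x ∈ W v) x (W v).zero_mem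
    (fun f g hf hg => (W v).add_mem hf hg) (fun p c => ?_)
  have h := (W v).smul_mem c (key v p)
  have h2 : c • (Finsupp.single p (1 : k)) = Finsupp.single p c := by simp
  rw [← h2]
  exact h

end Basic

section Perp
variable {k : Type u} [Field k] {V : Type u} [Quiver.{u} V]

instance : HasFiniteBiproducts (QRep k V) := Abelian.hasFiniteBiproducts

instance : HasExt.{u + 1} (QRep k V) := HasExt.standard _

/-- `M ⊥ N`: `Hom(M, N) = 0` and `Ext¹(M, N) = 0`. -/
def Orth (M N : QRep k V) : Prop :=
  Subsingleton (M ⟶ N) ∧ Subsingleton (Abelian.Ext M N 1)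

/-- `E` is exceptional: `Hom(E, E) ⊕ Ext¹(E, E)` is one-dimensional, generated by the identity. -/
def IsExceptional (E : QRep k V) : Prop :=
  fg k V E ∧ Module.finrank k (E ⟶ E) = 1 ∧ Submodule.span k {𝟙 E} = ⊤ ∧
    Subsingleton (Abelian.Ext E E 1)

/-- `E` is left and right Hom-finite: the spaces `Hom(E, X)`, `Ext¹(E, X)`, `Hom(X, E)` and
`Ext¹(X, E)` are finite-dimensional for every finitely generated `X`. -/
def IsHomFinite (E : QRep k V) : Prop :=
  ∀ X : QRep k V, fg k V X →
    Module.Finite k (E ⟶ X) ∧ Module.Finite k (Abelian.Ext E X 1) ∧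
    Module.Finite k (X ⟶ E) ∧ Module.Finite k (Abelian.Ext X E 1)

/-- The right orthogonal category `E^⊥` inside `Mod(Q)`, as a property of objects. -/
def perp (E : QRep k V) : ObjectProperty (FGRep k V) := fun N => Orth E N.obj

end Perp

section Contraction

variable {V : Type u} [Quiver.{u} V]

/-- The vertices of the contracted quiver: all vertices except `i`. -/
structure Contract (i : V) : Type u where
  /-- the underlying vertex -/
  vertex : V
  /-- it is not the contracted one -/
  ne : vertex ≠ i

instance (i : V) [dec : DecidableEq V] : DecidableEq (Contract i) := fun v w =>
  decidable_of_iff (v.vertex = w.vertex) ⟨fun h => by cases v; cases w; congr, fun h => by rw [h]⟩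

instance (i : V) [Finite V] : Finite (Contract i) :=
  Finite.of_injective Contract.vertex fun v w h => by cases v; cases w; congr

/-- The contraction of the quiver at `i`: the arrows `v ⟶ w` are the old ones, and one arrow
for every pair of an arrow `v ⟶ i` and an arrow `i ⟶ w`. -/
instance (i : V) : Quiver.{u} (Contract i) where
  Hom v w := (v.vertex ⟶ w.vertex) ⊕ (v.vertex ⟶ i) × (i ⟶ w.vertex)

/-- An old arrow, as an arrow of the contracted quiver. -/
def Contract.old {i : V} {v w : Contract i} (a : v.vertex ⟶ w.vertex) : v ⟶ w := Sum.inl a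

/-- The arrow of the contracted quiver that replaces the pair `v ⟶ i ⟶ w`. -/
def Contract.pair {i : V} {v w : Contract i} (a : v.vertex ⟶ i) (b : i ⟶ w.vertex) : v ⟶ w :=
  Sum.inr (a, b)

/-- The functor from paths of the contracted quiver to paths of the quiver: an old arrow goes to
itself, a new arrow `(a, b)` to the path "first `a`, then `b`". -/
def contractPaths (i : V) : Paths (Contract i) ⥤ Paths V :=
  Paths.lift
    { obj := fun v => (Paths.of V).obj v.vertex
      map := fun {_ _} f => match f with
        | Sum.inl a => (Paths.of V).map a
        | Sum.inr (a, b) => (Paths.of V).map a ≫ (Paths.of V).map b }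

/-- The arrows out of `i` that end at another vertex, with their targets. -/
abbrev Out (i : V) : Type u := Σ w : Contract i, (i ⟶ w.vertex)

/-- The arrows into `i` that start at another vertex, with their sources. -/
abbrev In (i : V) : Type u := Σ w : Contract i, (w.vertex ⟶ i)

variable (k : Type u) [Field k]

/-- The contraction functor on representations: forget the space at `i`, keep the maps of the old
arrows, and let `(a, b)` act as the composite `M_v ⟶ M_i ⟶ M_w`. -/
def contraction (i : V) : QRep k V ⥤ QRep k (Contract i) :=
  (Functor.whiskeringLeft _ _ _).obj (contractPaths i)

variable {k}

/-- The space of the inserted representation at `v`: for `v = i` the direct sum, over the arrows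
out of `i`, of the spaces at their targets; otherwise the old space. -/
def insObj {i : V} (N : QRep k (Contract i)) (v : V) : Decidable (v = i) → ModuleCat.{u} k
  | isTrue _ => ModuleCat.of k ((b : Out i) → N.at b.1)
  | isFalse h => N.at ⟨v, h⟩

/-- The maps of the inserted representation: an arrow `a` into `i` acts by all the maps of the
arrows `(a, b)`, where `b` runs over the arrows out of `i`; an arrow `b` out of `i` acts by
the projection to the summand of `b`; all other arrows act as before. (Loops at `i` act by zero;
there are none when `S_i` is exceptional.) -/
def insMap {i : V} (N : QRep k (Contract i)) {v w : V} :
    (dv : Decidable (v = i)) → (dw : Decidable (w = i)) → (v ⟶ w) →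
      (insObj N v dv ⟶ insObj N w dw)
  | isTrue _, isTrue _, _ => ModuleCat.ofHom 0
  | isTrue hv, isFalse hw, b =>
      ModuleCat.ofHom (LinearMap.proj (φ := fun b : Out i => N.at b.1) ⟨⟨w, hw⟩, hv ▸ b⟩)
  | isFalse hv, isTrue hw, a =>
      ModuleCat.ofHom (LinearMap.pi fun b : Out i =>
        (N.arrow (Contract.pair (v := ⟨v, hv⟩) (hw ▸ a) b.2)).hom)
  | isFalse hv, isFalse hw, a => N.arrow (Contract.old (v := ⟨v, hv⟩) (w := ⟨w, hw⟩) a)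

/-- The insertion on morphisms, vertex by vertex. -/
def insApp {i : V} {N N' : QRep k (Contract i)} (f : N ⟶ N') (v : V) :
    (dv : Decidable (v = i)) → (insObj N v dv ⟶ insObj N' v dv)
  | isTrue _ => ModuleCat.ofHom (LinearMap.pi fun b : Out i =>
      (f.app _).hom ∘ₗ LinearMap.proj (φ := fun b : Out i => N.at b.1) b)
  | isFalse _ => f.app _

theorem insApp_naturality {i : V} {N N' : QRep k (Contract i)} (f : N ⟶ N') {v w : V}
    (dv : Decidable (v = i)) (dw : Decidable (w = i)) (a : v ⟶ w) :
    insMap N dv dw a ≫ insApp f w dw = insApp f v dv ≫ insMap N' dv dw a := by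
  cases dv with
  | isTrue hv =>
    cases dw with
    | isTrue hw =>
      ext x
      exact map_zero (insApp f w (isTrue hw)).hom
    | isFalse hw =>
      subst hv
      ext x
      rfl
  | isFalse hv =>
    cases dw with
    | isTrue hw =>
      subst hw
      ext x : 2
      funext b
      exact ConcreteCategory.congr_hom
        (f.naturality ((Paths.of _).map (Contract.pair (v := ⟨v, hv⟩) a b.2))) x
    | isFalse hw => exact f.naturality _

theorem insApp_id {i : V} (N : QRep k (Contract i)) (v : V) (dv : Decidable (v = i)) :
    insApp (𝟙 N) v dv = 𝟙 _ := by
  cases dv <;> rfl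

theorem insApp_comp {i : V} {N N' N'' : QRep k (Contract i)} (f : N ⟶ N') (g : N' ⟶ N'')
    (v : V) (dv : Decidable (v = i)) :
    insApp (f ≫ g) v dv = insApp f v dv ≫ insApp g v dv := by
  cases dv <;> rfl

variable (k)

/-- The inserted representation of the quiver. -/
def insRep [dec : DecidableEq V] {i : V} (N : QRep k (Contract i)) : QRep k V :=
  Paths.lift
    { obj := fun v => insObj N v (dec v i)
      map := fun {v w} a => insMap N (dec v i) (dec w i) a }

theorem insRep_arrow [dec : DecidableEq V] {i : V} (N : QRep k (Contract i)) {v w : V}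
    (a : v ⟶ w) : (insRep k N).arrow a = insMap N (dec v i) (dec w i) a :=
  Paths.lift_toPath _ a

/-- The insertion functor from representations of the contracted quiver to representations of the
quiver. -/
def insertion [dec : DecidableEq V] (i : V) : QRep k (Contract i) ⥤ QRep k V where
  obj N := insRep k N
  map f := homMk (fun v => insApp f v (dec v i)) (fun a => by
    rw [insRep_arrow, insRep_arrow]
    exact insApp_naturality f _ _ a)
  map_id N := by
    ext v : 2
    exact insApp_id N v _
  map_comp f g := by
    ext v : 2
    exact insApp_comp f g v _

end Contraction

end QuiverContraction

/-! The radical of `P_i` has the nontrivial paths from `i` as a basis, and splitting off the first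
arrow shows that it is free on the arrows out of `i`: a map from it to `M` is a family in `∏_{b : i
→ w} M_w`. Applying `Hom(-, M)` to `0 → rad P_i → P_i → S_i → 0` therefore exhibits `Hom(S_i, M)`
and `Ext¹(S_i, M)` as kernel and cokernel of `outMap M i`, the map `M_i → ∏_b M_w` given by all
arrows out of `i`. So `M` lies in `S_i^⊥` exactly when `outMap M i` is bijective
(`orth_simple_iff`), that is, when `M_i` can be recovered from the other spaces. The same
computation for `M = S_i` shows that a loop at `i` would give a self-extension (`isEmpty_loop`).

Without loops, contraction is left adjoint to insertion (`contractionAdjunction`). The unit is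
`outMap` at `i` and the identity elsewhere; the counit is the identity up to identification of
spaces. Hence insertion is fully faithful, and its essential image consists of the `M` with
bijective `outMap M i`.

Finite generation must still be transported. For contraction, generators at `i` are replaced by
their images along the arrows out of `i` (`contraction_fg`). For insertion, Hom-finiteness enters
(`fg_of_contraction_fg`): the subrepresentation `X` generated at the old vertices agrees with `M`
away from `i`, and since `M_i = ∏_b M_w`, the quotient `M_i / X_i` is `Ext¹(S_i, X)`, so finitely
many further generators at `i` suffice.

Uniqueness of left adjoints identifies every `π_i` with contraction. The formulas then come from
counting paths: a path between old vertices is a unique path of the contracted quiver, a path from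
`i` to an old vertex is uniquely an arrow out of `i` followed by such a path, and dually for paths
into `i`. -/

namespace QuiverContraction

/-! ## Connecting map out of a projective presentation -/

section Connecting

universe v' u' w' t
variable {R : Type t} [CommRing R] {C : Type u'} [Category.{v'} C] [Abelian C] [Linear R C]
  [HasExt.{w'} C] {S : ShortComplex C}

/-- The connecting map `Hom(X₁, Y) → Ext¹(X₃, Y)` of a short exact sequence, as a linear map. -/
noncomputable def connecting (R : Type t) [CommRing R] [Linear R C] (hS : S.ShortExact) (Y : C) :
    (S.X₁ ⟶ Y) →ₗ[R] Abelian.Ext S.X₃ Y 1 :=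
  Abelian.Ext.precompOfLinear hS.extClass R Y (add_zero 1) ∘ₗ
    (Abelian.Ext.linearEquiv₀ (R := R)).symm.toLinearMap

theorem connecting_apply (hS : S.ShortExact) {Y : C} (f : S.X₁ ⟶ Y) :
    connecting R hS Y f = hS.extClass.comp (Abelian.Ext.mk₀ f) (add_zero 1) := rfl

/-- Exactness of the contravariant long exact sequence at `Hom(X₁, Y)`. -/
theorem connecting_eq_zero_iff (hS : S.ShortExact) {Y : C} (f : S.X₁ ⟶ Y) :
    connecting R hS Y f = 0 ↔ ∃ g : S.X₂ ⟶ Y, S.f ≫ g = f := by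
  rw [connecting_apply]
  constructor
  · intro h
    obtain ⟨x, hx⟩ := Abelian.Ext.contravariant_sequence_exact₁ hS Y _ _ h
    obtain ⟨g, rfl⟩ := Abelian.Ext.addEquiv₀.symm.surjective x
    refine ⟨g, Abelian.Ext.addEquiv₀.symm.injective ?_⟩
    simpa using hx
  · rintro ⟨g, rfl⟩
    rw [← Abelian.Ext.mk₀_comp_mk₀]
    exact hS.extClass_comp_assoc _

/-- The next term of the long exact sequence, `Ext¹(X₂, Y)`, vanishes. -/
theorem connecting_surjective (hS : S.ShortExact) [Projective S.X₂] (Y : C) :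
    Function.Surjective (connecting R hS Y) := by
  intro x
  obtain ⟨y, hy⟩ := Abelian.Ext.contravariant_sequence_exact₃ hS Y x
    (Abelian.Ext.eq_zero_of_projective _) (add_zero 1)
  obtain ⟨g, rfl⟩ := Abelian.Ext.addEquiv₀.symm.surjective y
  exact ⟨g, hy⟩

end Connecting

/-! ## Decomposition of paths by the first arrow -/

section FirstArrow

variable {V : Type u} [Quiver.{u} V]

/-- The arrows out of `i`, with their targets. -/
abbrev Star (i : V) : Type u := Σ w : V, (i ⟶ w)

/-- The nontrivial paths from `i` to `v`, decomposed as the first arrow and the rest. -/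
abbrev StarPath (i : V) (v : Paths V) : Type u := Σ b : Star i, ((Paths.of V).obj b.1 ⟶ v)

/-- The path with the given first arrow and rest. -/
def StarPath.toPath {i : V} {v : Paths V} (p : StarPath i v) : (Paths.of V).obj i ⟶ v :=
  (Paths.of V).map p.1.2 ≫ p.2

/-- The first arrow of the nontrivial path `p` followed by `a`, and the rest of that path. -/
def splitCons {i : V} : {v w : V} → Quiver.Path i v → (v ⟶ w) → StarPath i w
  | _, w, .nil, a => ⟨⟨w, a⟩, 𝟙 _⟩
  | _, _, .cons q b, a => ⟨(splitCons q b).1, (splitCons q b).2 ≫ (Paths.of V).map a⟩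

/-- The first arrow and the rest of a path, or `none` for the trivial path. -/
def splitPath {i : V} : {v : V} → Quiver.Path i v → Option (StarPath i v)
  | _, .nil => none
  | _, .cons p a => some (splitCons p a)

theorem splitCons_comp {i w : V} (b : i ⟶ w) {v v' : V} (q : Quiver.Path w v) (a : v ⟶ v') :
    splitCons (b.toPath.comp q) a = ⟨⟨w, b⟩, q.cons a⟩ := by
  induction q generalizing v' with
  | nil => rfl
  | cons q c ih =>
    change (⟨(splitCons (b.toPath.comp q) c).1, _ ≫ _⟩ : StarPath i v') = _
    rw [ih]
    rfl

/-- Paths grow at their end, so the first arrow has to be found by recursion; this left inverse is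
what makes `StarPath.toPath` injective. -/
theorem splitPath_toPath {i v : V} (p : StarPath i ((Paths.of V).obj v)) :
    splitPath p.toPath = some p := by
  obtain ⟨⟨w, b⟩, q⟩ := p
  change splitPath (b.toPath.comp q) = _
  change Quiver.Path w v at q
  cases q with
  | nil => rfl
  | cons q a => exact congrArg some (splitCons_comp b q a)

theorem StarPath.toPath_injective {i : V} (v : Paths V) :
    Function.Injective (StarPath.toPath : StarPath i v → _) := fun p q h => by
  have e : @splitPath V _ i v p.toPath = @splitPath V _ i v q.toPath := by rw [h]
  exact Option.some_injective _
    ((@splitPath_toPath V _ i v p).symm.trans (e.trans (@splitPath_toPath V _ i v q)))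

theorem StarPath.toPath_comp {i : V} {v w : Paths V} (p : StarPath i v) (q : v ⟶ w) :
    StarPath.toPath ⟨p.1, p.2 ≫ q⟩ = p.toPath ≫ q := (Category.assoc _ _ _).symm

/-- A path is trivial or has a first arrow. -/
theorem eq_id_or_exists_starPath {i : V} {v : Paths V} (p : (Paths.of V).obj i ⟶ v) :
    (∃ h : (Paths.of V).obj i = v, p = eqToHom h) ∨ ∃ q : StarPath i v, q.toPath = p := by
  refine Paths.induction_fixed_source (P := fun {v} p =>
    (∃ h : (Paths.of V).obj i = v, p = eqToHom h) ∨ ∃ q : StarPath i v, q.toPath = p)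
    (Or.inl ⟨rfl, rfl⟩) ?_ p
  rintro v w p a (⟨h, rfl⟩ | ⟨q, rfl⟩)
  · change i = v at h
    subst h
    exact Or.inr ⟨⟨⟨w, a⟩, 𝟙 _⟩, (Category.comp_id _).trans (Category.id_comp _).symm⟩
  · exact Or.inr ⟨_, q.toPath_comp _⟩

end FirstArrow

/-! ## The standard presentation of a simple representation -/

section Presentation

variable {k : Type u} [Field k] {V : Type u} [Quiver.{u} V]

theorem QRep.hom_arrow {M N : QRep k V} (f : M ⟶ N) {v w : V} (a : v ⟶ w) (x : M.at v) :
    (f.app _).hom ((M.arrow a).hom x) = (N.arrow a).hom ((f.app _).hom x) :=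
  ConcreteCategory.congr_hom (f.naturality ((Paths.of V).map a)) x

theorem proj_map_single {j : V} {v w : Paths V} (p : (Paths.of V).obj j ⟶ v) (q : v ⟶ w) (c : k) :
    ((proj k j).map q).hom (Finsupp.single p c) = Finsupp.single (p ≫ q) c :=
  Finsupp.mapDomain_single

/-- The map from `P_j` that sends the trivial path to the given element. -/
noncomputable def projHom {j : V} (M : QRep k V) (x : M.at j) : proj k j ⟶ M where
  app v := ModuleCat.ofHom (Finsupp.linearCombination k
    (fun p : (Paths.of V).obj j ⟶ v => (M.map p).hom x))
  naturality v w q := by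
    ext : 1
    refine Finsupp.lhom_ext fun p c => ?_
    refine (congrArg (Finsupp.linearCombination k _) (proj_map_single p q c)).trans ?_
    refine (Finsupp.linearCombination_single k c _).trans ?_
    refine Eq.trans ?_ (congrArg (M.map q).hom (Finsupp.linearCombination_single k c _).symm)
    simp

theorem projHom_single {j : V} (M : QRep k V) (x : M.at j) {v : Paths V}
    (p : (Paths.of V).obj j ⟶ v) (c : k) :
    ((projHom M x).app v).hom (Finsupp.single p c) = c • (M.map p).hom x :=
  Finsupp.linearCombination_single k c p

/-- The generator of `P_j`. -/
noncomputable def projGen (k : Type u) [Field k] {V : Type u} [Quiver.{u} V] (j : V) :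
    (proj k j).at j := Finsupp.single (𝟙 _) (1 : k)

theorem projHom_gen {j : V} (M : QRep k V) (x : M.at j) :
    ((projHom M x).app _).hom (projGen k j) = x := by
  simp [projGen, projHom_single]

/-- Yoneda: the basis element of a path `p` is the image of the generator under `p`, so naturality
determines a map by its value there. -/
theorem projHom_ext {j : V} {M : QRep k V} {f g : proj k j ⟶ M}
    (h : (f.app _).hom (projGen k j) = (g.app _).hom (projGen k j)) : f = g := by
  ext v : 2
  ext : 1
  refine Finsupp.lhom_ext' fun p => LinearMap.ext_ring ?_
  have e : (Finsupp.single p (1 : k) : (proj k j).obj v) = ((proj k j).map p).hom (projGen k j) := by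
    refine Eq.trans ?_ (proj_map_single _ _ _).symm
    rw [Category.id_comp]
  have h1 := ConcreteCategory.congr_hom (f.naturality p) (projGen k j)
  have h2 := ConcreteCategory.congr_hom (g.naturality p) (projGen k j)
  change (f.app v).hom (Finsupp.single p (1 : k)) = (g.app v).hom (Finsupp.single p (1 : k))
  rw [e]
  exact h1.trans ((congrArg (M.map p).hom h).trans h2.symm)

instance proj_projective (j : V) : Projective (proj k j) where
  factors {E X} f e _ := by
    -- Epimorphisms of representations are surjective at each vertex, so the value of `f` at the
    -- generator can be lifted.
    have : Epi (e.app ((Paths.of V).obj j)) := inferInstance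
    obtain ⟨x, hx⟩ := (ModuleCat.epi_iff_surjective _).1 this ((f.app _).hom (projGen k j))
    refine ⟨projHom E x, projHom_ext ?_⟩
    refine Eq.trans ?_ hx
    exact congrArg (e.app _).hom (projHom_gen E x)

variable (k) in
/-- The radical of `P_i`: at `v` the space with basis the nontrivial paths from `i` to `v`. -/
noncomputable def rad (i : V) : QRep k V where
  obj v := ModuleCat.of k (StarPath i v →₀ k)
  map q := ModuleCat.ofHom (Finsupp.lmapDomain k k (fun p => ⟨p.1, p.2 ≫ q⟩))
  map_id v := by
    ext : 1
    simp only [Category.comp_id]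
    exact Finsupp.lmapDomain_id k k
  map_comp p q := by
    ext : 1
    simp only [← Category.assoc]
    exact Finsupp.lmapDomain_comp k k (fun r : StarPath i _ => (⟨r.1, r.2 ≫ p⟩ : StarPath i _))
      (fun r : StarPath i _ => (⟨r.1, r.2 ≫ q⟩ : StarPath i _))

theorem rad_map_single {i : V} {v w : Paths V} (p : StarPath i v) (q : v ⟶ w) (c : k) :
    ((rad k i).map q).hom (Finsupp.single p c) = Finsupp.single ⟨p.1, p.2 ≫ q⟩ c :=
  Finsupp.mapDomain_single

variable (k) in
/-- The inclusion of the radical of `P_i`. -/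
noncomputable def radIncl (i : V) : rad k i ⟶ proj k i where
  app v := ModuleCat.ofHom (Finsupp.lmapDomain k k StarPath.toPath)
  naturality v w q := by
    ext : 1
    refine Finsupp.lhom_ext fun p c => ?_
    refine (congrArg (Finsupp.mapDomain _) (rad_map_single p q c)).trans ?_
    refine Finsupp.mapDomain_single.trans ?_
    refine Eq.trans ?_ (congrArg ((proj k i).map q).hom Finsupp.mapDomain_single.symm)
    refine Eq.trans ?_ (proj_map_single _ _ _).symm
    rw [p.toPath_comp]

theorem radIncl_single (i : V) {v : Paths V} (p : StarPath i v) (c : k) :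
    ((radIncl k i).app v).hom (Finsupp.single p c) = Finsupp.single p.toPath c :=
  Finsupp.mapDomain_single

instance radIncl_mono (i : V) : Mono (radIncl k i) := by
  have (v : Paths V) : Mono ((radIncl k i).app v) := (ModuleCat.mono_iff_injective _).2
    (Finsupp.mapDomain_injective (StarPath.toPath_injective v))
  exact NatTrans.mono_of_mono_app _

/-- The generators of the radical. -/
noncomputable def radGen (k : Type u) [Field k] {V : Type u} [Quiver.{u} V] {i : V} (b : Star i) :
    (rad k i).at b.1 := Finsupp.single ⟨b, 𝟙 _⟩ (1 : k)

/-- The map from the radical of `P_i` with the given values at the arrows out of `i`. -/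
noncomputable def radHom {i : V} (M : QRep k V) (y : (b : Star i) → M.at b.1) : rad k i ⟶ M where
  app v := ModuleCat.ofHom (Finsupp.linearCombination k
    (fun p : StarPath i v => (M.map p.2).hom (y p.1)))
  naturality v w q := by
    ext : 1
    refine Finsupp.lhom_ext fun p c => ?_
    refine (congrArg (Finsupp.linearCombination k _) (rad_map_single p q c)).trans ?_
    refine (Finsupp.linearCombination_single k c _).trans ?_
    refine Eq.trans ?_ (congrArg (M.map q).hom (Finsupp.linearCombination_single k c _).symm)
    simp

theorem radHom_gen {i : V} (M : QRep k V) (y : (b : Star i) → M.at b.1) (b : Star i) :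
    ((radHom M y).app _).hom (radGen k b) = y b := by
  refine (Finsupp.linearCombination_single k _ _).trans ?_
  simp

theorem radHom_ext {i : V} {M : QRep k V} {f g : rad k i ⟶ M}
    (h : ∀ b, (f.app _).hom (radGen k b) = (g.app _).hom (radGen k b)) : f = g := by
  ext v : 2
  ext : 1
  refine Finsupp.lhom_ext' fun p => LinearMap.ext_ring ?_
  have e : (Finsupp.single p (1 : k) : (rad k i).obj v) = ((rad k i).map p.2).hom (radGen k p.1) := by
    refine Eq.trans ?_ (rad_map_single _ _ _).symm
    rw [Category.id_comp]
  have h1 := ConcreteCategory.congr_hom (f.naturality p.2) (radGen k p.1)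
  have h2 := ConcreteCategory.congr_hom (g.naturality p.2) (radGen k p.1)
  change (f.app v).hom (Finsupp.single p (1 : k)) = (g.app v).hom (Finsupp.single p (1 : k))
  rw [e]
  exact h1.trans ((congrArg (M.map p.2).hom (h p.1)).trans h2.symm)

variable (k) in
theorem radIncl_gen {i : V} (b : Star i) :
    ((radIncl k i).app _).hom (radGen k b) = ((proj k i).arrow b.2).hom (projGen k i) := by
  refine (radIncl_single i _ _).trans (Eq.trans ?_ (proj_map_single _ _ _).symm)
  rw [StarPath.toPath, Category.comp_id, Category.id_comp]

/-- Evaluation at the generators identifies the maps from the radical with families of elements. -/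
noncomputable def radHomEquiv {i : V} (M : QRep k V) :
    (rad k i ⟶ M) ≃ₗ[k] ((b : Star i) → M.at b.1) where
  toFun f b := (f.app _).hom (radGen k b)
  map_add' _ _ := rfl
  map_smul' _ _ := rfl
  invFun y := radHom M y
  left_inv _ := radHom_ext fun b => radHom_gen _ _ b
  right_inv _ := funext fun b => radHom_gen _ _ b

/-- The maps along all arrows out of `i`. -/
def outMap (M : QRep k V) (i : V) : M.at i →ₗ[k] ((b : Star i) → M.at b.1) :=
  LinearMap.pi fun b => (M.arrow b.2).hom

/-- Identifies the restriction `Hom(P_i, M) → Hom(rad P_i, M)` with `outMap M i`: the inclusion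
sends the generator of `b` to the path `b`, which is `b` applied to the generator of `P_i`. -/
theorem radHomEquiv_radIncl {i : V} {M : QRep k V} (g : proj k i ⟶ M) :
    radHomEquiv M (radIncl k i ≫ g) = outMap M i ((g.app _).hom (projGen k i)) := by
  funext b
  change (g.app _).hom (((radIncl k i).app _).hom (radGen k b)) = _
  rw [radIncl_gen]
  exact QRep.hom_arrow g _ _

theorem radIncl_comp_eq_zero_iff {i : V} {M : QRep k V} (g : proj k i ⟶ M) :
    radIncl k i ≫ g = 0 ↔ outMap M i ((g.app _).hom (projGen k i)) = 0 := by
  rw [← radHomEquiv_radIncl, LinearEquiv.map_eq_zero_iff]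

variable [dec : DecidableEq V]

/-- The generator of the simple representation, in the space at `j`. -/
def simpleGenAux (k : Type u) [Field k] {V : Type u} {v j : V} (h : v = j) :
    (d : Decidable (v = j)) → simpleObj k d
  | isTrue _ => (1 : k)
  | isFalse h' => absurd h h'

/-- The component at `v` of the map from `S_j` that sends the generator to `x`. -/
def simpleAppAux {j : V} (M : QRep k V) (x : M.at j) {v : V} :
    (d : Decidable (v = j)) → simpleObj k d ⟶ M.at v
  | isTrue h => ModuleCat.ofHom (LinearMap.toSpanSingleton k (M.at v) (h ▸ x))
  | isFalse _ => 0

variable (k) in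
/-- The generator of the simple representation. -/
def simpleGen (j : V) : (simple k j).at j := simpleGenAux k rfl (dec j j)

theorem simple_arrow (j : V) {v w : V} (a : v ⟶ w) : (simple k j).arrow a = 0 :=
  Paths.lift_toPath _ a

/-- The map from `S_j` that sends the generator to an element killed by all arrows. -/
def simpleHom {j : V} (M : QRep k V) (x : M.at j) (hx : outMap M j x = 0) : simple k j ⟶ M :=
  homMk (fun v => simpleAppAux M x (dec v j)) (fun {v w} a => by
    rw [simple_arrow]
    refine zero_comp.trans ?_
    change 0 = simpleAppAux M x (dec v j) ≫ M.arrow a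
    -- The given decidability instance does not reduce; turning it into a variable allows a case
    -- distinction under which the spaces compute.
    generalize dec v j = d
    cases d with
    | isTrue h =>
      subst h
      ext : 1
      refine LinearMap.ext_ring ?_
      change (0 : M.at w) = (M.arrow a).hom ((1 : k) • x)
      rw [one_smul]
      exact (congrFun hx ⟨w, a⟩).symm
    | isFalse h => exact zero_comp.symm)

theorem simpleHom_gen {j : V} (M : QRep k V) (x : M.at j) (hx : outMap M j x = 0) :
    ((simpleHom M x hx).app _).hom (simpleGen k j) = x := by
  change (simpleAppAux M x (dec j j)).hom (simpleGenAux k rfl (dec j j)) = x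
  generalize dec j j = d
  cases d with
  | isTrue h => exact one_smul k x
  | isFalse h => exact absurd rfl h

theorem simpleHom_ext {j : V} {M : QRep k V} {f g : simple k j ⟶ M}
    (h : (f.app _).hom (simpleGen k j) = (g.app _).hom (simpleGen k j)) : f = g := by
  have key : ∀ {v : V} (hv : v = j) (d : Decidable (v = j)) {Y : ModuleCat.{u} k}
      (p q : simpleObj k d ⟶ Y), p.hom (simpleGenAux k hv d) = q.hom (simpleGenAux k hv d) →
      p = q := by
    intro v hv d Y p q hpq
    cases d with
    | isTrue h => ext : 1; exact LinearMap.ext_ring hpq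
    | isFalse h => exact absurd hv h
  have key' : ∀ {v : V} (hv : v ≠ j) (d : Decidable (v = j)) {Y : ModuleCat.{u} k}
      (p q : simpleObj k d ⟶ Y), p = q := by
    intro v hv d Y p q
    cases d with
    | isTrue h => exact absurd h hv
    | isFalse h =>
      ext x
      exact (map_zero p.hom).trans (map_zero q.hom).symm
  ext v : 2
  by_cases hv : v = j
  · subst hv
    exact key rfl (dec v v) _ _ h
  · exact key' hv (dec v j) _ _

theorem outMap_simpleGen (j : V) : outMap (simple k j) j (simpleGen k j) = 0 := by
  funext b
  change ((simple k j).arrow b.2).hom _ = 0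
  rw [simple_arrow]
  rfl

theorem simpleGen_ne_zero (j : V) : simpleGen k j ≠ 0 := by
  change simpleGenAux k rfl (dec j j) ≠ 0
  generalize dec j j = d
  cases d with
  | isTrue h => exact one_ne_zero (α := k)
  | isFalse h => exact absurd rfl h

variable (k) in
/-- The standard presentation `rad P_i → P_i → S_i`. -/
noncomputable def presentation (i : V) : ShortComplex (QRep k V) where
  f := radIncl k i
  g := projHom (simple k i) (simpleGen k i)
  zero := by
    rw [radIncl_comp_eq_zero_iff, projHom_gen]
    exact outMap_simpleGen i

/-- The top of `P_i` is `S_i`. -/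
noncomputable def presentationIsColimit (i : V) :
    IsColimit (CokernelCofork.ofπ (presentation k i).g (presentation k i).zero) :=
  CokernelCofork.IsColimit.ofπ _ _
    (fun {M} h hz => simpleHom M ((h.app _).hom (projGen k i)) ((radIncl_comp_eq_zero_iff h).1 hz))
    (fun {M} h hz => projHom_ext (by
      change ((simpleHom M _ _).app _).hom
        (((projHom (simple k i) (simpleGen k i)).app _).hom (projGen k i)) = _
      rw [projHom_gen, simpleHom_gen]
      rfl))
    (fun {M} h hz m hm => simpleHom_ext (by
      rw [simpleHom_gen, ← hm]
      change _ = (m.app _).hom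
        (((projHom (simple k i) (simpleGen k i)).app _).hom (projGen k i))
      rw [projHom_gen]
      rfl))

theorem presentation_shortExact (i : V) : (presentation k i).ShortExact where
  exact := (presentation k i).exact_of_g_is_cokernel (presentationIsColimit i)
  mono_f := radIncl_mono i
  epi_g := Cofork.IsColimit.epi (presentationIsColimit (k := k) i)

/-- The space `⨁_{b : i → w} M_w` maps onto `Ext¹(S_i, M)`. -/
noncomputable def outExt (M : QRep k V) (i : V) :
    ((b : Star i) → M.at b.1) →ₗ[k] Abelian.Ext (simple k i) M 1 :=
  connecting k (presentation_shortExact i) M ∘ₗ (radHomEquiv M).symm.toLinearMap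

theorem outExt_surjective (M : QRep k V) (i : V) : Function.Surjective (outExt M i) := by
  have : Projective (presentation k i).X₂ := proj_projective i
  exact (connecting_surjective (presentation_shortExact i) M).comp (radHomEquiv M).symm.surjective

/-- A family, seen as a map on `rad P_i`, has trivial class exactly when it extends to `P_i`; such
extensions are elements of `M_i`. -/
theorem ker_outExt (M : QRep k V) (i : V) :
    LinearMap.ker (outExt M i) = LinearMap.range (outMap M i) := by
  ext y
  refine (connecting_eq_zero_iff (presentation_shortExact i) ((radHomEquiv M).symm y)).trans ?_
  constructor
  · rintro ⟨g, hg⟩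
    refine ⟨(g.app _).hom (projGen k i), ?_⟩
    refine (radHomEquiv_radIncl (M := M) g).symm.trans ?_
    exact (congrArg (radHomEquiv M) hg).trans (LinearEquiv.apply_symm_apply _ _)
  · rintro ⟨x, rfl⟩
    refine ⟨projHom M x, (LinearEquiv.symm_apply_eq _).2 ?_ |>.symm⟩
    refine Eq.trans ?_ (radHomEquiv_radIncl (projHom M x)).symm
    rw [projHom_gen]

/-- `M` is right orthogonal to `S_i` if and only if `M_i` is the sum of the spaces at the targets
of the arrows out of `i`. -/
theorem orth_simple_iff (M : QRep k V) (i : V) :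
    Orth (simple k i) M ↔ Function.Bijective (outMap M i) := by
  constructor
  · rintro ⟨h0, h1⟩
    refine ⟨(injective_iff_map_eq_zero _).2 fun x hx => ?_, ?_⟩
    · rw [← simpleHom_gen M x hx, Subsingleton.elim (simpleHom M x hx) 0]
      rfl
    · rw [← LinearMap.range_eq_top, ← ker_outExt, LinearMap.ker_eq_top]
      exact LinearMap.ext fun y => Subsingleton.elim _ _
  · rintro ⟨h0, h1⟩
    -- A map out of `S_i` sends the generator into the kernel of `outMap`; every extension class
    -- comes from a family, which lies in the range of `outMap`, hence in the kernel of `outExt`.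
    refine ⟨subsingleton_of_forall_eq 0 fun f => simpleHom_ext (h0 ?_),
      subsingleton_of_forall_eq 0 fun x => ?_⟩
    · funext b
      refine (QRep.hom_arrow f b.2 (simpleGen k i)).symm.trans ?_
      rw [simple_arrow]
      exact (map_zero (f.app _).hom).trans (congrFun (map_zero (outMap M i)) b).symm
    · obtain ⟨y, rfl⟩ := outExt_surjective M i x
      have : y ∈ LinearMap.ker (outExt M i) := by
        rw [ker_outExt, LinearMap.range_eq_top.2 h1]
        trivial
      exact this

/-- There is no loop at `i` if `S_i` has no self-extensions. -/
theorem isEmpty_loop {i : V} (h : Subsingleton (Abelian.Ext (simple k i) (simple k i) 1)) :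
    IsEmpty (i ⟶ i) := by
  classical
  refine ⟨fun a => simpleGen_ne_zero (k := k) i ?_⟩
  -- The family supported at the loop `a` has trivial class, so it lies in the range of `outMap`;
  -- but that map is zero, since all arrows of `S_i` are.
  obtain ⟨x, hx⟩ : Pi.single (M := fun b : Star i => (simple k i).at b.1) ⟨i, a⟩ (simpleGen k i) ∈
      LinearMap.range (outMap (simple k i) i) := by
    rw [← ker_outExt]
    exact Subsingleton.elim _ _
  have := congrFun hx ⟨i, a⟩
  rw [Pi.single_eq_same] at this
  rw [← this]
  change ((simple k i).arrow a).hom x = 0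
  rw [simple_arrow]
  rfl

end Presentation
/-! ## The adjunction between contraction and insertion -/

section Adjunction

variable {k : Type u} [Field k] {V : Type u} [Quiver.{u} V] {i : V}

theorem contractPaths_map_old {v w : Contract i} (a : v.vertex ⟶ w.vertex) :
    (contractPaths i).map ((Paths.of _).map (Contract.old (v := v) (w := w) a)) =
      (Paths.of V).map a :=
  Paths.lift_toPath _ _

theorem contractPaths_map_pair {v w : Contract i} (a : v.vertex ⟶ i) (b : i ⟶ w.vertex) :
    (contractPaths i).map ((Paths.of _).map (Contract.pair (v := v) (w := w) a b)) =
      (Paths.of V).map a ≫ (Paths.of V).map b :=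
  Paths.lift_toPath _ _

theorem contraction_arrow_old (M : QRep k V) {v w : Contract i} (a : v.vertex ⟶ w.vertex) :
    ((contraction k i).obj M).arrow (Contract.old (v := v) (w := w) a) = M.arrow a :=
  congrArg M.map (contractPaths_map_old a)

theorem contraction_arrow_pair (M : QRep k V) {v w : Contract i} (a : v.vertex ⟶ i)
    (b : i ⟶ w.vertex) :
    ((contraction k i).obj M).arrow (Contract.pair (v := v) (w := w) a b) =
      M.arrow a ≫ M.arrow b :=
  (congrArg M.map (contractPaths_map_pair a b)).trans (M.map_comp _ _)

/-- The component at `v` of the unit of the adjunction. -/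
def insUnitAux (M : QRep k V) {v : V} :
    (d : Decidable (v = i)) → (M.at v ⟶ insObj ((contraction k i).obj M) v d)
  | isTrue h => ModuleCat.ofHom (LinearMap.pi fun b : Out i =>
      (M.arrow (w := b.1.vertex) (h.symm ▸ b.2)).hom)
  | isFalse _ => 𝟙 (M.at v)

/-- Loops at `i` must be excluded here: they act by zero on the insertion, but possibly not on `M`.
For an arrow into `i`, the square commutes because the pair `(a, b)` acts on the contraction as the
composite. -/
theorem insUnitAux_arrow [IsEmpty (i ⟶ i)] (M : QRep k V) {v w : V} (dv : Decidable (v = i))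
    (dw : Decidable (w = i)) (a : v ⟶ w) :
    M.arrow a ≫ insUnitAux M dw = insUnitAux M dv ≫ insMap ((contraction k i).obj M) dv dw a := by
  cases dv with
  | isTrue hv =>
    subst hv
    cases dw with
    | isTrue hw =>
      subst hw
      exact isEmptyElim a
    | isFalse hw => exact Category.comp_id _
  | isFalse hv =>
    refine Eq.trans ?_ (Category.id_comp _).symm
    cases dw with
    | isTrue hw =>
      subst hw
      ext x : 2
      funext b
      exact (ConcreteCategory.congr_hom
        (contraction_arrow_pair M (v := ⟨v, hv⟩) (w := b.1) a b.2) x).symm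
    | isFalse hw =>
      refine (Category.comp_id _).trans ?_
      exact (contraction_arrow_old M (v := ⟨v, hv⟩) (w := ⟨w, hw⟩) a).symm

theorem insUnitAux_naturality {M M' : QRep k V} (f : M ⟶ M') {v : V} (d : Decidable (v = i)) :
    f.app ((Paths.of V).obj v) ≫ insUnitAux M' d =
      insUnitAux M d ≫ insApp ((contraction k i).map f) v d := by
  cases d with
  | isTrue h =>
    subst h
    ext x : 2
    funext b
    exact (QRep.hom_arrow f b.2 x).symm
  | isFalse h => exact (Category.comp_id _).trans (Category.id_comp _).symm

variable (k i) in
/-- The unit of the adjunction between contraction and insertion. -/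
def insUnit [dec : DecidableEq V] [IsEmpty (i ⟶ i)] :
    𝟭 (QRep k V) ⟶ contraction k i ⋙ insertion k i where
  app M := homMk (N := insRep k ((contraction k i).obj M)) (fun v => insUnitAux M (dec v i))
    (fun a => by
      rw [insRep_arrow]
      exact insUnitAux_arrow M _ _ a)
  naturality M M' f := by
    ext v : 2
    exact insUnitAux_naturality f (dec v i)

/-- The space of an inserted representation at an old vertex. -/
def insObjIso (N : QRep k (Contract i)) {v : V} (h : v ≠ i) :
    (d : Decidable (v = i)) → (insObj N v d ≅ N.at ⟨v, h⟩)
  | isTrue h' => absurd h' h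
  | isFalse _ => Iso.refl (N.at ⟨v, h⟩)

theorem insObjIso_old (N : QRep k (Contract i)) {v w : V} (hv : v ≠ i) (hw : w ≠ i)
    (dv : Decidable (v = i)) (dw : Decidable (w = i)) (a : v ⟶ w) :
    insMap N dv dw a ≫ (insObjIso N hw dw).hom =
      (insObjIso N hv dv).hom ≫ N.arrow (Contract.old (v := ⟨v, hv⟩) (w := ⟨w, hw⟩) a) := by
  cases dv with
  | isTrue h => exact absurd h hv
  | isFalse h =>
    cases dw with
    | isTrue h => exact absurd h hw
    | isFalse h => exact (Category.comp_id _).trans (Category.id_comp _).symm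

theorem insObjIso_pair (N : QRep k (Contract i)) {v w : V} (hv : v ≠ i) (hw : w ≠ i)
    (dv : Decidable (v = i)) (dw : Decidable (w = i)) (di : Decidable (i = i)) (a : v ⟶ i)
    (b : i ⟶ w) :
    (insMap N dv di a ≫ insMap N di dw b) ≫ (insObjIso N hw dw).hom =
      (insObjIso N hv dv).hom ≫ N.arrow (Contract.pair (v := ⟨v, hv⟩) (w := ⟨w, hw⟩) a b) := by
  cases dv with
  | isTrue h => exact absurd h hv
  | isFalse h =>
    cases dw with
    | isTrue h => exact absurd h hw
    | isFalse h =>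
      cases di with
      | isTrue h => rfl
      | isFalse h => exact absurd rfl h

theorem insObjIso_naturality {N N' : QRep k (Contract i)} (f : N ⟶ N') {v : V} (hv : v ≠ i)
    (d : Decidable (v = i)) :
    insApp f v d ≫ (insObjIso N' hv d).hom = (insObjIso N hv d).hom ≫ f.app _ := by
  cases d with
  | isTrue h => exact absurd h hv
  | isFalse h => exact (Category.comp_id _).trans (Category.id_comp _).symm

variable (k i) in
/-- The counit of the adjunction between contraction and insertion. -/
def insCounit [dec : DecidableEq V] :
    insertion k i ⋙ contraction k i ⟶ 𝟭 (QRep k (Contract i)) where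
  app N := homMk (M := (contraction k i).obj (insRep k N))
    (fun v => (insObjIso N v.ne (dec v.vertex i)).hom) (fun {v w} a => by
      rcases a with a | ⟨a, b⟩
      · refine (congrArg (· ≫ _) (contraction_arrow_old (insRep k N) a)).trans ?_
        rw [insRep_arrow]
        exact insObjIso_old N v.ne w.ne _ _ a
      · refine (congrArg (· ≫ _) (contraction_arrow_pair (insRep k N) a b)).trans ?_
        rw [insRep_arrow, insRep_arrow]
        exact insObjIso_pair N v.ne w.ne _ _ _ a b)
  naturality N N' f := by
    ext v : 2
    exact insObjIso_naturality f v.ne (dec v.vertex i)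

theorem insUnitAux_comp_insObjIso (M : QRep k V) {v : V} (h : v ≠ i) (d : Decidable (v = i)) :
    insUnitAux M d ≫ (insObjIso ((contraction k i).obj M) h d).hom = 𝟙 (M.at v) := by
  cases d with
  | isTrue h' => exact absurd h' h
  | isFalse h' => exact Category.comp_id _

/-- An arrow out of `i` reads off one coordinate. The space at `i` is a product only once the
instance is known to be `isTrue rfl`, so `hd` is kept as an equation and `x` is transported along
it. -/
theorem insMap_comp_insObjIso_apply (N : QRep k (Contract i)) (w : Contract i) (b : i ⟶ w.vertex)
    (d : Decidable (i = i)) (dw : Decidable (w.vertex = i)) (hd : d = isTrue rfl)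
    (x : insObj N i d) :
    (insMap N d dw b ≫ (insObjIso N w.ne dw).hom).hom x =
      (show (b : Out i) → N.at b.1 from (eqToHom (congrArg (insObj N i) hd)).hom x) ⟨w, b⟩ := by
  subst hd
  cases dw with
  | isTrue h => exact absurd h w.ne
  | isFalse h => rfl

theorem insObjIso_eq_eqToHom (N : QRep k (Contract i)) {v : V} (h : v ≠ i) (d : Decidable (v = i))
    (hd : d = isFalse h) : (insObjIso N h d).hom = eqToHom (congrArg (insObj N v) hd) := by
  subst hd
  rfl

variable [dec : DecidableEq V]

instance insCounit_app_isIso (N : QRep k (Contract i)) : IsIso ((insCounit k i).app N) := by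
  have (v : Paths (Contract i)) : IsIso (((insCounit k i).app N).app v) :=
    inferInstanceAs (IsIso (insObjIso N (Contract.ne v) (dec (Contract.vertex v) i)).hom)
  exact NatIso.isIso_of_isIso_app _

/-- The triangle identity at `v`, with one occurrence of the instance freed for case analysis; the
`eqToHom` is the identity when `hd` is `rfl`. -/
theorem insUnitAux_comp_insApp (N : QRep k (Contract i)) {v : V} (d : Decidable (v = i))
    (hd : dec v i = d) :
    insUnitAux (insRep k N) d ≫ insApp ((insCounit k i).app N) v d =
      eqToHom (congrArg (insObj N v) hd) := by
  cases d with
  | isTrue h =>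
    subst h
    ext x : 2
    funext b
    have := insMap_comp_insObjIso_apply N b.1 b.2 (dec v v) (dec b.1.vertex v) hd x
    refine Eq.trans ?_ this
    refine congrArg (insObjIso N b.1.ne (dec b.1.vertex v)).hom.hom ?_
    exact ConcreteCategory.congr_hom (insRep_arrow k N b.2) x
  | isFalse h =>
    exact (Category.id_comp _).trans (insObjIso_eq_eqToHom N h (dec v i) hd)

variable (k i) in
/-- Contraction is left adjoint to insertion. -/
def contractionAdjunction [IsEmpty (i ⟶ i)] : contraction k i ⊣ insertion k i :=
  Adjunction.mkOfUnitCounit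
    { unit := insUnit k i
      counit := insCounit k i
      left_triangle := by
        ext M v : 4
        exact insUnitAux_comp_insObjIso M (Contract.ne v) _
      right_triangle := by
        ext N v : 4
        exact insUnitAux_comp_insApp N (dec v i) rfl }

end Adjunction
/-! ## Finite generation -/

section FiniteGeneration

variable {k : Type u} [Field k] {V : Type u} [Quiver.{u} V]

theorem Star.ne {i : V} [IsEmpty (i ⟶ i)] (b : Star i) : b.1 ≠ i := by
  obtain ⟨w, b⟩ := b
  intro h
  change w = i at h
  subst h
  exact isEmptyElim b

/-- A family of subspaces is stable under the arrows. -/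
def IsStable (M : QRep k V) (W : (v : V) → Submodule k (M.at v)) : Prop :=
  ∀ (v w : V) (a : v ⟶ w) (x : M.at v), x ∈ W v → (M.arrow a).hom x ∈ W w

theorem fg_of_iso {M N : QRep k V} (f : M ≅ N) (h : fg k V M) : fg k V N := by
  obtain ⟨s, hs, hgen⟩ := h
  refine ⟨(fun p : (Σ v : V, M.at v) => (⟨p.1, (f.hom.app _).hom p.2⟩ : Σ v : V, N.at v)) '' s,
    hs.image _, fun W hW hsW v => ?_⟩
  have key := hgen (fun v => (W v).comap (f.hom.app ((Paths.of V).obj v)).hom)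
    (fun v w a x hx => by
      rw [Submodule.mem_comap, QRep.hom_arrow]
      exact hW _ _ a _ hx)
    (fun p hp => hsW _ ⟨p, hp, rfl⟩) v
  refine Submodule.eq_top_iff'.2 fun y => ?_
  have hy : (f.hom.app _).hom ((f.inv.app ((Paths.of V).obj v)).hom y) = y :=
    ConcreteCategory.congr_hom (f.inv_hom_id_app ((Paths.of V).obj v)) y
  rw [← hy]
  exact Submodule.eq_top_iff'.1 key _

/-- The smallest stable family of subspaces that contains the given elements. -/
def generated (M : QRep k V) (s : Set (Σ v : V, M.at v)) (v : V) : Submodule k (M.at v) :=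
  ⨅ W : {W : (v : V) → Submodule k (M.at v) // IsStable M W ∧ ∀ p ∈ s, p.2 ∈ W p.1}, W.1 v

theorem generated_isStable (M : QRep k V) (s : Set (Σ v : V, M.at v)) :
    IsStable M (generated M s) := fun v w a x hx =>
  (Submodule.mem_iInf _).2 fun W => W.2.1 v w a x ((Submodule.mem_iInf _).1 hx W)

theorem mem_generated (M : QRep k V) (s : Set (Σ v : V, M.at v)) {p : Σ v : V, M.at v}
    (hp : p ∈ s) : p.2 ∈ generated M s p.1 :=
  (Submodule.mem_iInf _).2 fun W => W.2.2 p hp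

theorem generated_le {M : QRep k V} {s : Set (Σ v : V, M.at v)}
    {W : (v : V) → Submodule k (M.at v)} (hW : IsStable M W) (hs : ∀ p ∈ s, p.2 ∈ W p.1) (v : V) :
    generated M s v ≤ W v := iInf_le (fun W : {W : (v : V) → Submodule k (M.at v) //
      IsStable M W ∧ ∀ p ∈ s, p.2 ∈ W p.1} => W.1 v) ⟨W, hW, hs⟩

/-- The subrepresentation on a stable family of subspaces. -/
def subRep {M : QRep k V} {W : (v : V) → Submodule k (M.at v)} (hW : IsStable M W) : QRep k V :=
  Paths.lift
    { obj := fun v => ModuleCat.of k (W v)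
      map := fun {v w} a => ModuleCat.ofHom ((M.arrow a).hom.restrict (hW v w a)) }

theorem subRep_arrow {M : QRep k V} {W : (v : V) → Submodule k (M.at v)} (hW : IsStable M W)
    {v w : V} (a : v ⟶ w) :
    (subRep hW).arrow a = ModuleCat.ofHom ((M.arrow a).hom.restrict (hW v w a)) :=
  Paths.lift_toPath _ a

/-- A stable family inside the subrepresentation that contains `s` is also a stable family in `M`,
so by minimality it contains everything generated by `s`. -/
theorem subRep_generated_fg (M : QRep k V) {s : Set (Σ v : V, M.at v)} (hs : s.Finite) :
    fg k V (subRep (generated_isStable M s)) := by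
  refine ⟨(fun p : s => (⟨p.1.1, ⟨p.1.2, mem_generated M s p.2⟩⟩ :
    Σ v : V, generated M s v)) '' Set.univ, ?_, fun W hW hsW v => ?_⟩
  · have := hs.to_subtype
    exact Set.finite_univ.image _
  · change (v : V) → Submodule k (generated M s v) at W
    refine Submodule.eq_top_iff'.2 fun (x : generated M s v) => ?_
    have hle := generated_le (M := M) (s := s) (W := fun v => (W v).map (generated M s v).subtype)
      (by
        rintro v w a _ ⟨x, hx, rfl⟩
        refine ⟨_, hW v w a x hx, ?_⟩
        rw [subRep_arrow]
        rfl)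
      (fun p hp => ⟨_, hsW _ ⟨⟨p, hp⟩, trivial, rfl⟩, rfl⟩) v x.2
    obtain ⟨y, hy, hyx⟩ := hle
    exact (Subtype.ext hyx : y = x) ▸ hy

/-- The contraction of a finitely generated representation is finitely generated. -/
theorem contraction_fg [Finite V] [∀ v w : V, Finite (v ⟶ w)] {i : V} [IsEmpty (i ⟶ i)]
    {M : QRep k V} (h : fg k V M) : fg k (Contract i) ((contraction k i).obj M) := by
  obtain ⟨s, hs, hgen⟩ := h
  have h1 : {p : Σ v : Contract i, M.at v.vertex | (⟨p.1.vertex, p.2⟩ : Σ v : V, M.at v) ∈ s}.Finite :=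
    hs.preimage (f := fun p : (Σ v : Contract i, M.at v.vertex) =>
      (⟨p.1.vertex, p.2⟩ : Σ v : V, M.at v)) (by
        rintro ⟨⟨v, hv⟩, x⟩ - ⟨⟨w, hw⟩, y⟩ - hpq
        dsimp only at hpq
        cases hpq
        rfl)
  have h2 : {x : M.at i | (⟨i, x⟩ : Σ v : V, M.at v) ∈ s}.Finite :=
    hs.preimage (f := fun x : M.at i => (⟨i, x⟩ : Σ v : V, M.at v)) (by
      rintro x - y - hxy
      dsimp only at hxy
      cases hxy
      rfl)
  -- Generators: those at old vertices, and the images of those at `i` under every arrow out of `i`.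
  refine ⟨_, h1.union (h2.image2 (fun x (b : Out i) =>
    (⟨b.1, (M.arrow b.2).hom x⟩ : Σ v : Contract i, M.at v.vertex)) (Set.finite_univ (α := Out i))),
    fun W hW hsW u => ?_⟩
  change (v : Contract i) → Submodule k (M.at v.vertex) at W
  -- The largest extension of `W` to `i` compatible with the arrows out of `i`: at `i`, the elements
  -- that all these arrows send into `W`. Stability along arrows into `i` is stability of `W` under
  -- the pairs.
  let W' (v : V) : Submodule k (M.at v) :=
    { carrier := {x | (∀ h : v ≠ i, x ∈ W ⟨v, h⟩) ∧
        (v = i → ∀ (w : Contract i) (b : v ⟶ w.vertex), (M.arrow b).hom x ∈ W w)}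
      add_mem' := fun {x y} hx hy => ⟨fun h => (W _).add_mem (hx.1 h) (hy.1 h), fun h w b => by
        rw [map_add]
        exact (W w).add_mem (hx.2 h w b) (hy.2 h w b)⟩
      zero_mem' := ⟨fun h => (W _).zero_mem, fun h w b => by
        rw [map_zero]
        exact (W w).zero_mem⟩
      smul_mem' := fun c x hx => ⟨fun h => (W _).smul_mem c (hx.1 h), fun h w b => by
        rw [map_smul]
        exact (W w).smul_mem c (hx.2 h w b)⟩ }
  have hW' : IsStable M W' := by
    intro v w a x hx
    refine ⟨fun hw => ?_, ?_⟩
    · by_cases hv : v = i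
      · exact hx.2 hv ⟨w, hw⟩ a
      · have := hW ⟨v, hv⟩ ⟨w, hw⟩ (Contract.old (v := ⟨v, hv⟩) (w := ⟨w, hw⟩) a) x (hx.1 hv)
        rw [contraction_arrow_old] at this
        exact this
    · intro hw w' b
      subst hw
      by_cases hv : v = w
      · subst hv
        exact isEmptyElim a
      · have := hW ⟨v, hv⟩ w' (Contract.pair (v := ⟨v, hv⟩) (w := w') a b) x (hx.1 hv)
        rw [contraction_arrow_pair] at this
        exact this
  have hs' : ∀ p ∈ s, p.2 ∈ W' p.1 := by
    rintro ⟨v, x⟩ hp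
    refine ⟨fun hv => hsW ⟨⟨v, hv⟩, x⟩ (Or.inl hp), ?_⟩
    rintro rfl w b
    exact hsW ⟨w, (M.arrow b).hom x⟩ (Or.inr ⟨x, hp, ⟨w, b⟩, trivial, rfl⟩)
  refine Submodule.eq_top_iff'.2 fun x => ?_
  exact (Submodule.eq_top_iff'.1 (hgen W' hW' hs' u.vertex) x).1 u.ne

/-- `Ext¹(S_i, M)` is the cokernel of `outMap M i`; lifting a finite spanning set of it gives `t`.
-/
theorem exists_finite_span_sup_range [DecidableEq V] (M : QRep k V) (i : V)
    (h : Module.Finite k (Abelian.Ext (simple k i) M 1)) :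
    ∃ t : Set ((b : Star i) → M.at b.1), t.Finite ∧
      Submodule.span k t ⊔ LinearMap.range (outMap M i) = ⊤ := by
  obtain ⟨τ, hτ⟩ := h.fg_top
  refine ⟨Function.surjInv (outExt_surjective M i) '' τ, τ.finite_toSet.image _, ?_⟩
  have : (Submodule.span k (Function.surjInv (outExt_surjective M i) '' τ)).map (outExt M i) = ⊤ := by
    rw [Submodule.map_span, Set.image_image]
    simpa only [Function.surjInv_eq, Set.image_id'] using hτ
  rw [← ker_outExt, ← Submodule.comap_map_eq, this, Submodule.comap_top]

/-- A representation that is right orthogonal to `S_i` is finitely generated if its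
contraction is. -/
theorem fg_of_contraction_fg [DecidableEq V] {i : V} [IsEmpty (i ⟶ i)]
    (hfin : ∀ X : QRep k V, fg k V X → Module.Finite k (Abelian.Ext (simple k i) X 1))
    {M : QRep k V} (hM : Function.Bijective (outMap M i))
    (h : fg k (Contract i) ((contraction k i).obj M)) : fg k V M := by
  obtain ⟨s, hs, hgen⟩ := h
  let s' : Set (Σ v : V, M.at v) := (fun p : (Σ v : Contract i, M.at v.vertex) =>
    (⟨p.1.vertex, p.2⟩ : Σ v : V, M.at v)) '' s
  have hs' : s'.Finite := hs.image _
  -- A family stable in `M` restricts to one stable in the contraction, so `s'` already generates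
  -- `M` away from `i`.
  have htop : ∀ W, IsStable M W → (∀ p ∈ s', p.2 ∈ W p.1) → ∀ v ≠ i, W v = ⊤ := by
    intro W hW hsW v hv
    refine hgen (fun v => W v.vertex) (fun v w a x hx => ?_) (fun p hp => hsW _ ⟨p, hp, rfl⟩) ⟨v, hv⟩
    rcases a with a | ⟨a, b⟩
    · have := contraction_arrow_old M a
      refine (congrArg (fun f => f.hom x ∈ W w.vertex) this).mpr ?_
      exact hW _ _ a x hx
    · have := contraction_arrow_pair M a b
      refine (congrArg (fun f => f.hom x ∈ W w.vertex) this).mpr ?_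
      exact hW _ _ b _ (hW _ _ a x hx)
  have hne (b : Star i) : b.1 ≠ i := Star.ne b
  let G := generated M s'
  have hG : IsStable M G := generated_isStable M s'
  let X := subRep hG
  -- Hom-finiteness is applied to `X`, which is known to be finitely generated, and not to `M`.
  obtain ⟨t, ht, hspan⟩ := exists_finite_span_sup_range X i (hfin X (subRep_generated_fg M hs'))
  let incl : ((b : Star i) → X.at b.1) →ₗ[k] ((b : Star i) → M.at b.1) :=
    LinearMap.pi fun b => (G b.1).subtype ∘ₗ LinearMap.proj b
  -- Surjectivity of `outMap M i` turns the families in `t` into elements of `M_i`; these are the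
  -- extra generators at `i`.
  choose lift hlift using fun y => hM.2 (incl y)
  refine ⟨s' ∪ (fun y => (⟨i, lift y⟩ : Σ v : V, M.at v)) '' t, hs'.union (ht.image _),
    fun W hW hsW v => ?_⟩
  have hsW' : ∀ p ∈ s', p.2 ∈ W p.1 := fun p hp => hsW p (Or.inl hp)
  by_cases hv : v = i
  · subst hv
    have hle : Submodule.span k t ⊔ LinearMap.range (outMap X v) ≤
        ((W v).map (outMap M v)).comap incl := by
      refine sup_le (Submodule.span_le.2 fun y hy => ?_) ?_
      · exact ⟨lift y, hsW _ (Or.inr ⟨y, hy, rfl⟩), hlift y⟩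
      · rintro _ ⟨x, rfl⟩
        change G v at x
        refine ⟨x.1, generated_le hW hsW' v x.2, ?_⟩
        funext b
        change _ = (G b.1).subtype (((subRep hG).arrow b.2).hom x)
        rw [subRep_arrow]
        rfl
    refine Submodule.eq_top_iff'.2 fun x => ?_
    have hx : ∀ b : Star v, outMap M v x b ∈ G b.1 := fun b => by
      rw [htop G hG (fun p hp => mem_generated M s' hp) b.1 (hne b)]
      trivial
    -- As `X` and `M` agree at the targets of the arrows, the image of `x` is a family in `X`. It is
    -- therefore the image of some `x'` in `W v`, and injectivity of `outMap` gives `x' = x`.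
    let z : (b : Star v) → X.at b.1 := fun b => (⟨outMap M v x b, hx b⟩ : G b.1)
    obtain ⟨x', hx', e⟩ := hle (hspan ▸ Submodule.mem_top : z ∈ _)
    exact hM.1 e ▸ hx'
  · exact htop W hW hsW' v hv

/-- Inserted representations are right orthogonal to `S_i`. -/
theorem outMap_insRep_bijective [dec : DecidableEq V] {i : V} [IsEmpty (i ⟶ i)]
    (N : QRep k (Contract i)) : Function.Bijective (outMap (insRep k N) i) := by
  have hne (b : Star i) : b.1 ≠ i := Star.ne b
  have hd : dec i i = isTrue rfl := Subsingleton.elim _ _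
  -- Under this identification `outMap` becomes the identity of the product, the arrows being the
  -- projections; since there are no loops, `Star i` and `Out i` index the same arrows.
  let e₁ : (insRep k N).at i ≃ₗ[k] ((b : Out i) → N.at b.1) :=
    (eqToIso (congrArg (insObj N i) hd)).toLinearEquiv
  have key (x : (insRep k N).at i) (b : Out i) : (insObjIso N b.1.ne (dec b.1.vertex i)).hom.hom
      (outMap (insRep k N) i x ⟨b.1.vertex, b.2⟩) = e₁ x b := by
    refine Eq.trans ?_ (insMap_comp_insObjIso_apply N b.1 b.2 (dec i i) (dec _ i) hd x)
    refine congrArg (insObjIso N b.1.ne (dec b.1.vertex i)).hom.hom ?_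
    exact ConcreteCategory.congr_hom (insRep_arrow k N b.2) x
  constructor
  · intro x y hxy
    refine e₁.injective (funext fun b => ?_)
    rw [← key, ← key, hxy]
  · intro y
    refine ⟨e₁.symm fun b => (insObjIso N b.1.ne (dec b.1.vertex i)).hom.hom (y ⟨b.1.vertex, b.2⟩),
      funext fun b => ?_⟩
    refine (insObjIso N (hne b) (dec b.1 i)).toLinearEquiv.injective ?_
    refine (key _ ⟨⟨b.1, hne b⟩, b.2⟩).trans ?_
    rw [LinearEquiv.apply_symm_apply]
    rfl

/-- The insertion of a finitely generated representation is finitely generated. -/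
theorem insertion_fg [DecidableEq V] {i : V} [IsEmpty (i ⟶ i)]
    (hfin : ∀ X : QRep k V, fg k V X → Module.Finite k (Abelian.Ext (simple k i) X 1))
    {N : QRep k (Contract i)} (h : fg k (Contract i) N) : fg k V ((insertion k i).obj N) :=
  fg_of_contraction_fg hfin (outMap_insRep_bijective N)
    (fg_of_iso (asIso ((insCounit k i).app N)).symm h)

/-- The unit of the adjunction is invertible on representations that are right orthogonal
to `S_i`. -/
theorem insUnit_app_isIso [dec : DecidableEq V] {i : V} [IsEmpty (i ⟶ i)] {M : QRep k V}
    (hM : Function.Bijective (outMap M i)) : IsIso ((insUnit k i).app M) := by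
  have hne (b : Star i) : b.1 ≠ i := Star.ne b
  have key : ∀ (v : V) (d : Decidable (v = i)), IsIso (insUnitAux M d) := by
    intro v d
    cases d with
    | isTrue h =>
      subst h
      refine (ConcreteCategory.isIso_iff_bijective _).2 ⟨fun x y hxy => hM.1 ?_, fun y => ?_⟩
      · funext b
        exact congrFun (hxy : (fun b : Out v => (M.arrow b.2).hom x) =
          fun b : Out v => (M.arrow b.2).hom y) ⟨⟨b.1, hne b⟩, b.2⟩
      · change (b : Out v) → M.at b.1.vertex at y
        obtain ⟨x, hx⟩ := hM.2 fun b => y ⟨⟨b.1, hne b⟩, b.2⟩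
        exact ⟨x, funext fun b => congrFun hx ⟨b.1.vertex, b.2⟩⟩
    | isFalse h => exact inferInstanceAs (IsIso (𝟙 (M.at v)))
  have (v : Paths V) : IsIso (((insUnit k i).app M).app v) := key v (dec v i)
  exact NatIso.isIso_of_isIso_app _

end FiniteGeneration
/-! ## Paths of the contracted quiver -/

section ContractedPaths

variable {V : Type u} [Quiver.{u} V] {i : V}

/-- The paths from `j` to `v` in terms of the contracted quiver: a path to `i` is a path of the
contracted quiver followed by an arrow into `i`, any other path is one of the contracted quiver. -/
def PathTo (j : Contract i) (v : V) : Decidable (v = i) → Type u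
  | isTrue _ => Σ a : In i, ((Paths.of (Contract i)).obj j ⟶ (Paths.of (Contract i)).obj a.1)
  | isFalse h => ((Paths.of (Contract i)).obj j ⟶ (Paths.of (Contract i)).obj ⟨v, h⟩)

namespace PathTo

/-- The path of the original quiver. -/
def realize {j : Contract i} {v : V} :
    (d : Decidable (v = i)) → PathTo j v d → ((Paths.of V).obj j.vertex ⟶ (Paths.of V).obj v)
  | isTrue h, s => (contractPaths i).map s.2 ≫ (Paths.of V).map (h.symm ▸ s.1.2)
  | isFalse _, q => (contractPaths i).map q

/-- Composition with an arrow. -/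
def step [IsEmpty (i ⟶ i)] {j : Contract i} {v w : V} :
    (dv : Decidable (v = i)) → (dw : Decidable (w = i)) → (v ⟶ w) → PathTo j v dv → PathTo j w dw
  | isTrue hv, isTrue hw, a, _ => isEmptyElim (show i ⟶ i from cast (by rw [hv, hw]) a)
  | isTrue hv, isFalse hw, b, s => (s.2 : _ ⟶ (Paths.of (Contract i)).obj s.1.1) ≫
      (Paths.of _).map (Contract.pair (w := ⟨w, hw⟩) s.1.2 (hv ▸ b))
  | isFalse hv, isTrue hw, a, q => ⟨⟨⟨v, hv⟩, hw ▸ a⟩, q⟩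
  | isFalse hv, isFalse hw, a, q =>
      (show (Paths.of _).obj j ⟶ (Paths.of (Contract i)).obj ⟨v, hv⟩ from q) ≫
        (Paths.of _).map (Contract.old (v := ⟨v, hv⟩) (w := ⟨w, hw⟩) a)

theorem realize_step [IsEmpty (i ⟶ i)] {j : Contract i} {v w : V} (dv : Decidable (v = i))
    (dw : Decidable (w = i)) (a : v ⟶ w) (t : PathTo j v dv) :
    realize dw (step dv dw a t) = realize dv t ≫ (Paths.of V).map a := by
  cases dv with
  | isTrue hv =>
    subst hv
    cases dw with
    | isTrue hw =>
      subst hw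
      exact isEmptyElim a
    | isFalse hw =>
      refine ((contractPaths v).map_comp _ _).trans ?_
      exact (congrArg (_ ≫ ·) (contractPaths_map_pair (w := ⟨w, hw⟩) t.1.2 a)).trans (Category.assoc _ _ _).symm
  | isFalse hv =>
    cases dw with
    | isTrue hw =>
      subst hw
      rfl
    | isFalse hw =>
      refine ((contractPaths i).map_comp _ _).trans ?_
      exact congrArg (_ ≫ ·) (contractPaths_map_old (v := ⟨v, hv⟩) (w := ⟨w, hw⟩) a)

/-- A path of the contracted quiver. -/
def ofPath {j v : Contract i} (q : (Paths.of (Contract i)).obj j ⟶ (Paths.of (Contract i)).obj v) :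
    (d : Decidable (v.vertex = i)) → PathTo j v.vertex d
  | isTrue h => absurd h v.ne
  | isFalse _ => q

theorem ofPath_injective {j v : Contract i} (d : Decidable (v.vertex = i)) :
    Function.Injective fun q => ofPath (j := j) (v := v) q d := by
  cases d with
  | isTrue h => exact absurd h v.ne
  | isFalse h => exact fun _ _ h => h

theorem exists_eq_ofPath {j v : Contract i} (d : Decidable (v.vertex = i))
    (t : PathTo j v.vertex d) : ∃ q, ofPath q d = t := by
  cases d with
  | isTrue h => exact absurd h v.ne
  | isFalse h => exact ⟨t, rfl⟩

theorem realize_ofPath {j v : Contract i} (d : Decidable (v.vertex = i))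
    (q : (Paths.of (Contract i)).obj j ⟶ (Paths.of (Contract i)).obj v) :
    realize d (ofPath q d) = (contractPaths i).map q := by
  cases d with
  | isTrue h => exact absurd h v.ne
  | isFalse h => rfl

theorem step_old [IsEmpty (i ⟶ i)] {j v w : Contract i} (dv : Decidable (v.vertex = i))
    (dw : Decidable (w.vertex = i))
    (q : (Paths.of (Contract i)).obj j ⟶ (Paths.of (Contract i)).obj v)
    (a : v.vertex ⟶ w.vertex) :
    step dv dw a (ofPath q dv) =
      ofPath (q ≫ (Paths.of _).map (Contract.old (v := v) (w := w) a)) dw := by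
  cases dv with
  | isTrue h => exact absurd h v.ne
  | isFalse h =>
    cases dw with
    | isTrue h => exact absurd h w.ne
    | isFalse h => rfl

/-- A passage through `i` stores the incoming arrow and merges it with the outgoing one into a
single new arrow. -/
theorem step_pair [IsEmpty (i ⟶ i)] {j v w : Contract i} (dv : Decidable (v.vertex = i))
    (di : Decidable (i = i)) (dw : Decidable (w.vertex = i))
    (q : (Paths.of (Contract i)).obj j ⟶ (Paths.of (Contract i)).obj v)
    (a : v.vertex ⟶ i) (b : i ⟶ w.vertex) :
    step di dw b (step dv di a (ofPath q dv)) =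
      ofPath (q ≫ (Paths.of _).map (Contract.pair (v := v) (w := w) a b)) dw := by
  cases dv with
  | isTrue h => exact absurd h v.ne
  | isFalse h =>
    cases dw with
    | isTrue h => exact absurd h w.ne
    | isFalse h =>
      cases di with
      | isTrue h => rfl
      | isFalse h => exact absurd rfl h

theorem step_in [IsEmpty (i ⟶ i)] {j v : Contract i} (dv : Decidable (v.vertex = i))
    (q : (Paths.of (Contract i)).obj j ⟶ (Paths.of (Contract i)).obj v) (a : v.vertex ⟶ i) :
    step dv (isTrue rfl) a (ofPath q dv) = ⟨⟨v, a⟩, q⟩ := by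
  cases dv with
  | isTrue h => exact absurd h v.ne
  | isFalse h => rfl

end PathTo

variable [dec : DecidableEq V] [IsEmpty (i ⟶ i)]

/-- The description of a path in terms of the contracted quiver. -/
def pathTo {j : Contract i} : {v : V} → Quiver.Path j.vertex v → PathTo j v (dec v i)
  | _, .nil => PathTo.ofPath (v := j) (𝟙 _) _
  | _, .cons p a => PathTo.step _ _ a (pathTo p)

/-- Gives surjectivity in the path bijections: every path starting at an old vertex comes from the
contracted quiver. -/
theorem realize_pathTo {j : Contract i} {v : V} (p : Quiver.Path j.vertex v) :
    PathTo.realize _ (pathTo p) = p := by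
  induction p with
  | nil => exact (PathTo.realize_ofPath _ _).trans ((contractPaths i).map_id _)
  | cons p a ih =>
    refine (PathTo.realize_step _ _ a (pathTo p)).trans ?_
    rw [ih]
    rfl

/-- Gives injectivity in the path bijections: a path of the contracted quiver is recovered from its
realization. -/
theorem pathTo_map {j v : Contract i}
    (q : (Paths.of (Contract i)).obj j ⟶ (Paths.of (Contract i)).obj v) :
    @pathTo V _ i _ _ j v.vertex ((contractPaths i).map q) = PathTo.ofPath q _ := by
  refine Paths.induction_fixed_source (P := fun {v : Contract i} q =>
    @pathTo V _ i _ _ j v.vertex ((contractPaths i).map q) = PathTo.ofPath q _) ?_ ?_ q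
  · exact congrArg (@pathTo V _ i _ _ j j.vertex) ((contractPaths i).map_id _)
  · intro v w q e ih
    rcases e with a | ⟨a, b⟩
    · refine (congrArg (@pathTo V _ i _ _ j w.vertex) (((contractPaths i).map_comp _ _).trans
        (congrArg ((contractPaths i).map q ≫ ·) (contractPaths_map_old a)))).trans ?_
      refine (congrArg (PathTo.step _ _ a) ih).trans ?_
      exact PathTo.step_old _ _ q a
    · refine (congrArg (@pathTo V _ i _ _ j w.vertex) (((contractPaths i).map_comp _ _).trans
        (congrArg ((contractPaths i).map q ≫ ·) (contractPaths_map_pair a b)))).trans ?_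
      refine (congrArg (fun x => PathTo.step _ _ b (PathTo.step _ (dec i i) a x)) ih).trans ?_
      exact PathTo.step_pair _ _ _ q a b

/-- The paths of the contracted quiver are the paths of the quiver between old vertices. -/
theorem contractPaths_map_bijective (j v : Contract i) :
    Function.Bijective fun q : (Paths.of (Contract i)).obj j ⟶ (Paths.of (Contract i)).obj v =>
      (contractPaths i).map q := by
  constructor
  · intro q q' h
    refine PathTo.ofPath_injective (dec v.vertex i) ?_
    refine (pathTo_map q).symm.trans (Eq.trans ?_ (pathTo_map q'))
    exact congrArg (@pathTo V _ i _ _ j v.vertex) h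
  · intro p
    obtain ⟨q, hq⟩ := PathTo.exists_eq_ofPath _ (@pathTo V _ i _ _ j v.vertex p)
    refine ⟨q, ?_⟩
    refine (PathTo.realize_ofPath (dec v.vertex i) q).symm.trans ?_
    rw [hq]
    exact realize_pathTo p

/-- The paths from `j` to `i` are the paths of the contracted quiver followed by an arrow
into `i`. -/
theorem inPath_bijective (j : Contract i) :
    Function.Bijective
      fun s : Σ a : In i, ((Paths.of (Contract i)).obj j ⟶ (Paths.of (Contract i)).obj a.1) =>
        ((contractPaths i).map s.2 ≫ (Paths.of V).map s.1.2 :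
          (Paths.of V).obj j.vertex ⟶ (Paths.of V).obj i) := by
  have hd : dec i i = isTrue rfl := Subsingleton.elim _ _
  constructor
  · rintro ⟨⟨v, a⟩, q⟩ ⟨⟨v', a'⟩, q'⟩ h
    have h' : PathTo.step _ (dec i i) a (PathTo.ofPath q (dec v.vertex i)) =
        PathTo.step _ (dec i i) a' (PathTo.ofPath q' (dec v'.vertex i)) := by
      rw [← pathTo_map, ← pathTo_map]
      exact congrArg (@pathTo V _ i _ _ j i) h
    rw [hd, PathTo.step_in, PathTo.step_in] at h'
    exact h'
  · intro p
    -- `PathTo` at `i` is a pair of an arrow and a path only for `isTrue rfl`, so the instance is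
    -- varied first.
    have key (d : Decidable (i = i)) (hd' : dec i i = d) :
        ∃ t : PathTo j i d, PathTo.realize d t = p := by
      subst hd'
      exact ⟨_, realize_pathTo p⟩
    exact key _ hd

/-- The paths from `i` to `v` are the arrows out of `i` followed by a path of the contracted
quiver. -/
theorem outPath_bijective (v : Contract i) :
    Function.Bijective
      fun s : Σ b : Out i, ((Paths.of (Contract i)).obj b.1 ⟶ (Paths.of (Contract i)).obj v) =>
        ((Paths.of V).map s.1.2 ≫ (contractPaths i).map s.2 :
          (Paths.of V).obj i ⟶ (Paths.of V).obj v.vertex) := by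
  constructor
  · rintro ⟨⟨⟨w, hw⟩, b⟩, q⟩ ⟨⟨⟨w', hw'⟩, b'⟩, q'⟩ h
    -- The first arrow and the rest are unique, and the rest runs between old vertices, where the
    -- contracted path is unique.
    have := StarPath.toPath_injective (i := i) ((Paths.of V).obj v.vertex)
      (a₁ := ⟨⟨w, b⟩, (contractPaths i).map q⟩) (a₂ := ⟨⟨w', b'⟩, (contractPaths i).map q'⟩) h
    obtain ⟨h1, h2⟩ := Sigma.mk.inj_iff.1 this
    cases h1
    have := (contractPaths_map_bijective _ _).1 (eq_of_heq h2)
    rw [this]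
  · intro p
    rcases eq_id_or_exists_starPath p with ⟨h, -⟩ | ⟨⟨b, q⟩, rfl⟩
    · exact absurd h.symm v.ne
    · obtain ⟨q', hq'⟩ := (contractPaths_map_bijective ⟨b.1, Star.ne b⟩ v).2 q
      exact ⟨⟨⟨⟨b.1, Star.ne b⟩, b.2⟩, q'⟩, congrArg (_ ≫ ·) hq'⟩

end ContractedPaths
/-! ## Contractions of simple, projective and injective representations -/

theorem Contract.vertex_inj {V : Type u} {i : V} {v w : Contract i} :
    v.vertex = w.vertex ↔ v = w :=
  ⟨fun h => by cases v; cases w; congr, fun h => by rw [h]⟩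

section Formulas

variable {k : Type u} [Field k] {V : Type u} [Quiver.{u} V] {i : V}

section Simple

variable [dec : DecidableEq V]

/-- The spaces of simple representations at corresponding vertices. -/
def simpleObjIso {W W' : Type u} {v j : W} {v' j' : W'} (h : v = j ↔ v' = j') :
    (d : Decidable (v = j)) → (d' : Decidable (v' = j')) → (simpleObj k d ≅ simpleObj k d')
  | isTrue _, isTrue _ => Iso.refl (ModuleCat.of k k)
  | isTrue h₁, isFalse h₂ => absurd (h.1 h₁) h₂
  | isFalse h₁, isTrue h₂ => absurd (h.2 h₂) h₁
  | isFalse _, isFalse _ => Iso.refl (ModuleCat.of k PUnit.{u + 1})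

variable (k) in
theorem contraction_simple_arrow (j : V) {v w : Contract i} (a : v ⟶ w) :
    ((contraction k i).obj (simple k j)).arrow a = 0 := by
  rcases a with a | ⟨a, b⟩
  · exact (contraction_arrow_old _ a).trans (simple_arrow j a)
  · refine (contraction_arrow_pair _ a b).trans ?_
    rw [simple_arrow]
    exact zero_comp

variable (k) in
/-- The contraction of `S_j` is `S_j`. -/
theorem contraction_simple (j : Contract i) :
    Nonempty ((contraction k i).obj (simple k j.vertex) ≅ simple k j) := by
  let e (v : Contract i) : ((contraction k i).obj (simple k j.vertex)).at v ≅ (simple k j).at v :=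
    simpleObjIso Contract.vertex_inj (dec v.vertex j.vertex) _
  let f : (contraction k i).obj (simple k j.vertex) ⟶ simple k j :=
    homMk (fun v => (e v).hom) (fun a => by
      rw [contraction_simple_arrow, simple_arrow, zero_comp, comp_zero])
  have (v : Paths (Contract i)) : IsIso (f.app v) := inferInstanceAs (IsIso (e v).hom)
  have : IsIso f := NatIso.isIso_of_isIso_app _
  exact ⟨asIso f⟩

variable (k i) in
/-- The contraction of `S_i` is zero. -/
theorem isZero_contraction_simple : IsZero ((contraction k i).obj (simple k i)) := by
  refine Functor.isZero _ fun (v : Contract i) => ?_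
  have key (d : Decidable (v.vertex = i)) : IsZero (simpleObj k d) := by
    cases d with
    | isTrue h => exact absurd h v.ne
    | isFalse h => exact ModuleCat.isZero_of_subsingleton (ModuleCat.of k PUnit.{u + 1})
  exact key (dec v.vertex i)

end Simple

theorem proj_arrow_gen {v w : V} (b : v ⟶ w) :
    ((proj k v).arrow b).hom (projGen k v) = Finsupp.single ((Paths.of V).map b) (1 : k) := by
  refine (proj_map_single _ _ _).trans ?_
  rw [Category.id_comp]

theorem contraction_proj_map_single {j : V} {v w : Paths (Contract i)}
    (p : (Paths.of V).obj j ⟶ (contractPaths i).obj v) (q : v ⟶ w) (c : k) :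
    (((contraction k i).obj (proj k j)).map q).hom (Finsupp.single p c) =
      Finsupp.single (p ≫ (contractPaths i).map q) c :=
  Finsupp.mapDomain_single

variable (k i) in
/-- The inclusions of the summands of the contraction of `P_i`. -/
noncomputable def contractionProjCofan : Cofan fun b : Out i => proj k b.1 :=
  Cofan.mk ((contraction k i).obj (proj k i)) fun b =>
    projHom _ (((proj k i).arrow b.2).hom (projGen k i))

theorem contractionProjCofan_inj_gen (b : Out i) :
    (((contractionProjCofan k i).inj b).app _).hom (projGen k b.1) =
      (Finsupp.single ((Paths.of V).map b.2) (1 : k) :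
        ((Paths.of V).obj i ⟶ (Paths.of V).obj b.1.vertex) →₀ k) :=
  (projHom_gen _ _).trans (proj_arrow_gen b.2)

/-- The functions on the paths to `i` that a family of maps to the `I_w` associates with an
element. -/
noncomputable def fanValue (s : Fan fun a : In i => inj k a.1) {v : Paths (Contract i)} (x : s.pt.obj v)
    (t : Σ a : In i, (v ⟶ (Paths.of (Contract i)).obj a.1)) : k :=
  (show (v ⟶ (Paths.of (Contract i)).obj t.1.1) → k from ((s.proj t.1).app v).hom x) t.2

/-- Paths act on an injective by precomposition in its function arguments, so this is naturality of
the legs. -/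
theorem fanValue_map (s : Fan fun a : In i => inj k a.1) {v w : Paths (Contract i)} (q : v ⟶ w)
    (x : s.pt.obj v) (t : Σ a : In i, (w ⟶ (Paths.of (Contract i)).obj a.1)) :
    fanValue s ((s.pt.map q).hom x) t = fanValue s x ⟨t.1, q ≫ t.2⟩ :=
  congrArg (fun f : (w ⟶ (Paths.of (Contract i)).obj t.1.1) → k => f t.2)
    (ConcreteCategory.congr_hom ((s.proj t.1).naturality q) x)

section

variable [DecidableEq V] [IsEmpty (i ⟶ i)]

variable (k) in
/-- The contraction of `P_j` is `P_j`. -/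
theorem contraction_proj (j : Contract i) :
    Nonempty ((contraction k i).obj (proj k j.vertex) ≅ proj k j) := by
  let f : proj k j ⟶ (contraction k i).obj (proj k j.vertex) :=
    projHom _ (projGen k j.vertex)
  -- On basis elements `f` sends a contracted path to its realization, so the bijection of paths
  -- makes it an isomorphism.
  have hf (v : Paths (Contract i)) : (f.app v).hom =
      Finsupp.lmapDomain k k fun q : (Paths.of (Contract i)).obj j ⟶ v =>
        (contractPaths i).map q := by
    refine Finsupp.lhom_ext fun q c => ?_
    refine (projHom_single _ _ q c).trans ?_
    refine (congrArg (c • ·) (contraction_proj_map_single _ q 1)).trans ?_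
    refine Eq.trans ?_ Finsupp.mapDomain_single.symm
    refine (Finsupp.smul_single' _ _ _).trans ?_
    rw [mul_one]
    exact congrArg (Finsupp.single · c) (Category.id_comp _)
  have (v : Paths (Contract i)) : IsIso (f.app v) := by
    refine (ConcreteCategory.isIso_iff_bijective _).2 ?_
    have hb := contractPaths_map_bijective j v
    refine (congrArg (fun g : _ →ₗ[k] _ => Function.Bijective g) (hf v)).mpr ?_
    refine ⟨Finsupp.mapDomain_injective hb.1, Finsupp.mapDomain_surjective hb.2⟩
  have : IsIso f := NatIso.isIso_of_isIso_app _
  exact ⟨(asIso f).symm⟩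

variable (k) in
/-- The contraction of `I_j` is `I_j`. -/
theorem contraction_inj (j : Contract i) :
    Nonempty ((contraction k i).obj (inj k j.vertex) ≅ inj k j) := by
  let f : (contraction k i).obj (inj k j.vertex) ⟶ inj k j :=
    { app := fun v => ModuleCat.ofHom (LinearMap.funLeft k k
        (fun q : v ⟶ (Paths.of (Contract i)).obj j => (contractPaths i).map q))
      naturality := fun v w p => by
        ext x : 2
        funext q
        exact congrArg (show ((Paths.of V).obj (Contract.vertex v) ⟶ (Paths.of V).obj j.vertex) → k from x)
          ((contractPaths i).map_comp p q).symm }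
  have (v : Paths (Contract i)) : IsIso (f.app v) := by
    refine (ConcreteCategory.isIso_iff_bijective _).2 ?_
    exact (LinearEquiv.funCongrLeft k k
      (Equiv.ofBijective _ (contractPaths_map_bijective v j))).bijective
  have : IsIso f := NatIso.isIso_of_isIso_app _
  exact ⟨asIso f⟩

/-- The paths from `i` to `v`, as arrows out of `i` followed by a path of the contracted quiver. -/
noncomputable def outPathEquiv (i : V) [IsEmpty (i ⟶ i)] (v : Paths (Contract i)) :
    (Σ b : Out i, ((Paths.of (Contract i)).obj b.1 ⟶ v)) ≃
      ((Paths.of V).obj i ⟶ (contractPaths i).obj v) :=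
  Equiv.ofBijective _ (outPath_bijective v)

theorem outPathEquiv_apply {v : Paths (Contract i)} (b : Out i)
    (q : (Paths.of (Contract i)).obj b.1 ⟶ v) :
    outPathEquiv i v ⟨b, q⟩ = (Paths.of V).map b.2 ≫ (contractPaths i).map q := rfl

theorem outPathEquiv_comp {v w : Paths (Contract i)}
    (s : Σ b : Out i, ((Paths.of (Contract i)).obj b.1 ⟶ v)) (q : v ⟶ w) :
    outPathEquiv i w ⟨s.1, s.2 ≫ q⟩ = outPathEquiv i v s ≫ (contractPaths i).map q := by
  refine Eq.trans ?_ (Category.assoc _ _ _).symm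
  exact congrArg ((Paths.of V).map s.1.2 ≫ ·) ((contractPaths i).map_comp _ _)

variable (k i) in
/-- The contraction of `P_i` is a coproduct. -/
noncomputable def contractionProjIsColimit : IsColimit (contractionProjCofan k i) :=
  Cofan.IsColimit.mk _
    (fun s =>
      -- A path from `i` is uniquely `b` followed by a contracted path `q`; its basis element goes
      -- to the value of the leg at `b` on `q`.
      { app := fun v => ModuleCat.ofHom (Finsupp.linearCombination k
          (fun p : (Paths.of V).obj i ⟶ (contractPaths i).obj v =>
            ((s.inj ((outPathEquiv i v).symm p).1).app v).hom
              (Finsupp.single ((outPathEquiv i v).symm p).2 (1 : k))))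
        naturality := fun v w q => by
          ext : 1
          refine Finsupp.lhom_ext fun p c => ?_
          obtain ⟨t, rfl⟩ := (outPathEquiv i v).surjective p
          refine (congrArg (Finsupp.linearCombination k _)
            (contraction_proj_map_single _ q c)).trans ?_
          refine (Finsupp.linearCombination_single k c _).trans ?_
          refine Eq.trans ?_ (congrArg (s.pt.map q).hom
            (Finsupp.linearCombination_single k c _).symm)
          rw [← outPathEquiv_comp, Equiv.symm_apply_apply, Equiv.symm_apply_apply, map_smul]
          refine congrArg (c • ·) ?_
          refine Eq.trans ?_ (ConcreteCategory.congr_hom ((s.inj t.1).naturality q)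
            (Finsupp.single t.2 (1 : k)))
          exact congrArg ((s.inj t.1).app w).hom (proj_map_single _ _ _).symm })
    (fun s b => projHom_ext (by
      refine (congrArg (Finsupp.linearCombination k _) (contractionProjCofan_inj_gen b)).trans ?_
      refine (Finsupp.linearCombination_single k _ _).trans ?_
      have : (Paths.of V).map b.2 = outPathEquiv i _ ⟨b, 𝟙 _⟩ := by
        rw [outPathEquiv_apply]
        exact (Category.comp_id _).symm
      rw [one_smul, this, Equiv.symm_apply_apply]
      rfl))
    (fun s m hm => by
      ext v : 2
      ext : 1
      refine Finsupp.lhom_ext' fun p => LinearMap.ext_ring ?_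
      refine Eq.trans ?_ (Finsupp.linearCombination_single k _ _).symm
      obtain ⟨t, rfl⟩ := (outPathEquiv i v).surjective p
      rw [Equiv.symm_apply_apply, one_smul, ← hm]
      refine congrArg (m.app v).hom ?_
      refine Eq.trans ?_ (projHom_single _ _ _ _).symm
      rw [one_smul]
      exact ((congrArg (((contraction k i).obj (proj k i)).map t.2).hom
        (proj_arrow_gen t.1.2)).trans (contraction_proj_map_single _ _ _)).symm)

variable (k i) in
/-- The contraction of `P_i` is the sum of the `P_w` over the arrows `i → w`. -/
theorem contraction_proj_self [Finite (Out i)] :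
    Nonempty ((contraction k i).obj (proj k i) ≅ ⨁ fun b : Out i => proj k b.1) :=
  ⟨(contractionProjIsColimit k i).coconePointUniqueUpToIso (biproduct.isColimit _)⟩

/-- The paths from `v` to `i`, as paths of the contracted quiver followed by an arrow into `i`. -/
noncomputable def inPathEquiv (i : V) [IsEmpty (i ⟶ i)] (v : Paths (Contract i)) :
    (Σ a : In i, (v ⟶ (Paths.of (Contract i)).obj a.1)) ≃
      ((contractPaths i).obj v ⟶ (Paths.of V).obj i) :=
  Equiv.ofBijective _ (inPath_bijective v)

theorem inPathEquiv_comp {v w : Paths (Contract i)} (q : v ⟶ w)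
    (s : Σ a : In i, (w ⟶ (Paths.of (Contract i)).obj a.1)) :
    inPathEquiv i v ⟨s.1, q ≫ s.2⟩ = (contractPaths i).map q ≫ inPathEquiv i w s := by
  refine Eq.trans ?_ (Category.assoc _ _ _)
  exact congrArg (· ≫ (Paths.of V).map s.1.2) ((contractPaths i).map_comp _ _)

variable (k i) in
/-- The projections to the factors of the contraction of `I_i`. -/
noncomputable def contractionInjFan : Fan fun a : In i => inj k a.1 :=
  Fan.mk ((contraction k i).obj (inj k i)) fun a =>
    { app := fun v => ModuleCat.ofHom (LinearMap.funLeft k k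
        (fun q : v ⟶ (Paths.of (Contract i)).obj a.1 => inPathEquiv i v ⟨a, q⟩))
      naturality := fun v w p => by
        ext x : 2
        funext q
        exact congrArg (show ((contractPaths i).obj v ⟶ (Paths.of V).obj i) → k from x)
          (inPathEquiv_comp p ⟨a, q⟩).symm }

variable (k i) in
/-- The contraction of `I_i` is a product. -/
noncomputable def contractionInjIsLimit : IsLimit (contractionInjFan k i) :=
  Fan.IsLimit.mk _
    (fun s =>
      { app := fun v => ModuleCat.ofHom
          -- Dually, a path to `i` is uniquely a contracted path `q` followed by `a`; the function
          -- takes there the value at `q` prescribed by the leg at `a`.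
          { toFun := fun x (p : (contractPaths i).obj v ⟶ (Paths.of V).obj i) =>
              fanValue s x ((inPathEquiv i v).symm p)
            map_add' := fun x y => funext fun p => congrFun
              (map_add ((s.proj ((inPathEquiv i v).symm p).1).app v).hom x y) _
            map_smul' := fun c x => funext fun p => congrFun
              (map_smul ((s.proj ((inPathEquiv i v).symm p).1).app v).hom c x) _ }
        naturality := fun v w q => by
          ext x : 2
          funext p
          obtain ⟨t, rfl⟩ := (inPathEquiv i w).surjective p
          change fanValue s ((s.pt.map q).hom x) ((inPathEquiv i w).symm (inPathEquiv i w t)) =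
            fanValue s x ((inPathEquiv i v).symm ((contractPaths i).map q ≫ inPathEquiv i w t))
          rw [← inPathEquiv_comp, Equiv.symm_apply_apply, Equiv.symm_apply_apply, fanValue_map] })
    (fun s a => by
      ext v : 2
      ext x : 2
      funext q
      change fanValue s x ((inPathEquiv i v).symm (inPathEquiv i v ⟨a, q⟩)) = fanValue s x ⟨a, q⟩
      rw [Equiv.symm_apply_apply])
    (fun s m hm => by
      ext v : 2
      ext x : 2
      funext p
      obtain ⟨t, rfl⟩ := (inPathEquiv i v).surjective p
      change _ = fanValue s x ((inPathEquiv i v).symm (inPathEquiv i v t))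
      rw [Equiv.symm_apply_apply, fanValue, ← hm]
      rfl)

variable (k i) in
/-- The contraction of `I_i` is the sum of the `I_w` over the arrows `w → i`. -/
theorem contraction_inj_self [Finite (In i)] :
    Nonempty ((contraction k i).obj (inj k i) ≅ ⨁ fun a : In i => inj k a.1) :=
  ⟨(contractionInjIsLimit k i).conePointUniqueUpToIso (biproduct.isLimit _)⟩

end
end Formulas
/-! ## The equivalence with the right orthogonal category -/

section Equivalence

variable {k : Type u} [Field k] {V : Type u} [Quiver.{u} V] [DecidableEq V] {i : V}
  [IsEmpty (i ⟶ i)]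

variable (k i) in
/-- The contraction of finitely generated representations. -/
def fgContraction [Finite V] [∀ v w : V, Finite (v ⟶ w)] : FGRep k V ⥤ FGRep k (Contract i) :=
  (fg k (Contract i)).lift ((fg k V).ι ⋙ contraction k i) fun M => contraction_fg M.property

/-- The insertion of finitely generated representations. -/
def fgInsertion
    (hfin : ∀ X : QRep k V, fg k V X → Module.Finite k (Abelian.Ext (simple k i) X 1)) :
    FGRep k (Contract i) ⥤ FGRep k V :=
  (fg k V).lift ((fg k (Contract i)).ι ⋙ insertion k i) fun N => insertion_fg hfin N.property

variable (hfin : ∀ X : QRep k V, fg k V X → Module.Finite k (Abelian.Ext (simple k i) X 1))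

/-- The adjunction between contraction and insertion of finitely generated representations. -/
noncomputable def fgAdjunction [Finite V] [∀ v w : V, Finite (v ⟶ w)] :
    fgContraction k i ⊣ fgInsertion hfin :=
  (contractionAdjunction k i).restrictFullyFaithful (fg k V).fullyFaithfulι
    (fg k (Contract i)).fullyFaithfulι (Iso.refl _) (Iso.refl _)

variable (k i) in
/-- The insertion is fully faithful. -/
noncomputable def insertionFullyFaithful : (insertion k i).FullyFaithful :=
  -- A right adjoint is fully faithful when the counit is invertible.
  have : IsIso (contractionAdjunction k i).counit := by
    have (N : QRep k (Contract i)) : IsIso ((contractionAdjunction k i).counit.app N) :=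
      insCounit_app_isIso N
    exact NatIso.isIso_of_isIso_app _
  (contractionAdjunction k i).fullyFaithfulROfIsIsoCounit

/-- The insertion as a functor to the right orthogonal category. -/
def perpInsertion : FGRep k (Contract i) ⥤ (perp (simple k i)).FullSubcategory :=
  (perp (simple k i)).lift (fgInsertion hfin) fun N =>
    (orth_simple_iff _ i).2 (outMap_insRep_bijective N.obj)

/-- The insertion to the right orthogonal category is fully faithful. -/
noncomputable def perpInsertionFullyFaithful : (perpInsertion hfin).FullyFaithful :=
  Functor.FullyFaithful.ofCompFaithful (G := (perp (simple k i)).ι ⋙ (fg k V).ι)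
    ((fg k (Contract i)).fullyFaithfulι.comp (insertionFullyFaithful k i))

/-- Essential surjectivity: for `M` orthogonal to `S_i` the unit identifies `M` with the insertion
of its contraction, which is again finitely generated. -/
theorem perpInsertion_isEquivalence [Finite V] [∀ v w : V, Finite (v ⟶ w)] :
    (perpInsertion hfin).IsEquivalence where
  full := (perpInsertionFullyFaithful hfin).full
  faithful := (perpInsertionFullyFaithful hfin).faithful
  essSurj :=
    ⟨fun M => by
      have := insUnit_app_isIso ((orth_simple_iff M.obj.obj i).1 M.property)
      let N := (perpInsertion hfin).obj ((fgContraction k i).obj M.obj)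
      have f := @asIso _ _ _ _ ((insUnit k i).app M.obj.obj) this
      have g : M.obj ≅ N.obj := (fg k V).fullyFaithfulι.preimageIso (X := M.obj) (Y := N.obj) f
      exact ⟨_, ⟨((perp (simple k i)).fullyFaithfulι.preimageIso (X := M) (Y := N) g).symm⟩⟩⟩

end Equivalence
end QuiverContraction

open QuiverContraction in
theorem mainTheorem11 {k : Type u} [Field k] {V : Type u} [Quiver.{u} V] [Finite V]
    [∀ v w : V, Finite (v ⟶ w)] [DecidableEq V] (i : V)
    (hE : IsExceptional (simple k i)) (hfin : IsHomFinite (simple k i)) :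
    -- the inclusion of `S_i^⊥` into `Mod(Q)` has a left adjoint
    (perp (simple k i)).ι.IsRightAdjoint ∧
    -- `S_i^⊥` is equivalent to `Mod(Q_i)`, where `Q_i` is the contracted quiver, in such a way that
    ∃ e : FGRep k (Contract i) ≌ (perp (simple k i)).FullSubcategory,
      -- `ι_i` (the equivalence followed by the inclusion) is the insertion, and
      Nonempty ((e.functor ⋙ (perp (simple k i)).ι) ⋙ (fg k V).ι ≅
        (fg k (Contract i)).ι ⋙ insertion k i) ∧
      -- for every left adjoint of the inclusion, with `π_i` its composite with the equivalence,
      ∀ proj_perp : FGRep k V ⥤ (perp (simple k i)).FullSubcategory,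
        Nonempty (proj_perp ⊣ (perp (simple k i)).ι) →
        ∀ pi_i : FGRep k V ⥤ FGRep k (Contract i), pi_i = proj_perp ⋙ e.inverse →
          -- `π_i` is the contraction
          Nonempty (pi_i ⋙ (fg k (Contract i)).ι ≅ (fg k V).ι ⋙ contraction k i) ∧
          -- `π_i(S_j)`
          (∀ j : Contract i, Nonempty (pi_i.obj ⟨simple k j.vertex, simple_fg k j.vertex⟩ ≅
            ⟨simple k j, simple_fg k j⟩)) ∧
          IsZero (pi_i.obj ⟨simple k i, simple_fg k i⟩) ∧
          -- `π_i(P_j)`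
          (∀ j : Contract i, Nonempty (pi_i.obj ⟨proj k j.vertex, proj_fg k j.vertex⟩ ≅
            ⟨proj k j, proj_fg k j⟩)) ∧
          Nonempty ((pi_i.obj ⟨proj k i, proj_fg k i⟩).obj ≅ ⨁ fun a : Out i => proj k a.1) ∧
          -- `π_i(I_j)`, for the `I_j` that lie in `Mod(Q)`
          (∀ (j : Contract i) (h : fg k V (inj k j.vertex)),
            Nonempty ((pi_i.obj ⟨inj k j.vertex, h⟩).obj ≅ inj k j)) ∧
          (∀ h : fg k V (inj k i),
            Nonempty ((pi_i.obj ⟨inj k i, h⟩).obj ≅ ⨁ fun a : In i => inj k a.1)) ∧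
          -- and the same for all `I_j`, with the contraction of arbitrary representations
          (∀ j : Contract i, Nonempty ((contraction k i).obj (inj k j.vertex) ≅ inj k j)) ∧
          Nonempty ((contraction k i).obj (inj k i) ≅ ⨁ fun a : In i => inj k a.1) := by
  have : IsEmpty (i ⟶ i) := isEmpty_loop hE.2.2.2
  have hfin' : ∀ X : QRep k V, fg k V X → Module.Finite k (Abelian.Ext (simple k i) X 1) :=
    fun X hX => (hfin X hX).2.1
  have : (perpInsertion hfin').IsEquivalence := perpInsertion_isEquivalence hfin'
  let e := (perpInsertion hfin').asEquivalence
  have adj : fgContraction k i ⊣ e.functor ⋙ (perp (simple k i)).ι := fgAdjunction hfin'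
  refine ⟨?_, e, ⟨Iso.refl _⟩, ?_⟩
  · have : (e.functor ⋙ (perp (simple k i)).ι).IsRightAdjoint := adj.isRightAdjoint
    -- Up to isomorphism the inclusion is the inverse equivalence followed by the insertion, and
    -- both are right adjoints.
    exact Functor.isRightAdjoint_of_iso
      ((Functor.associator _ _ _).symm ≪≫ Functor.isoWhiskerRight e.counitIso _ ≪≫
        Functor.leftUnitor _ : e.inverse ⋙ e.functor ⋙ (perp (simple k i)).ι ≅ _)
  · rintro L ⟨adjL⟩ π rfl
    -- Both functors are left adjoint to the equivalence followed by the inclusion.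
    have α : L ⋙ e.inverse ≅ fgContraction k i :=
      (adjL.comp e.symm.toAdjunction).leftAdjointUniq adj
    have β (M : FGRep k V) : ((L ⋙ e.inverse).obj M).obj ≅ (contraction k i).obj M.obj :=
      (fg k (Contract i)).ι.mapIso (α.app M)
    refine ⟨⟨Functor.isoWhiskerRight α _⟩, fun j => ?_, ?_, fun j => ?_, ?_, fun j h => ?_,
      fun h => ?_, contraction_inj k, contraction_inj_self k i⟩
    · exact (contraction_simple k j).map fun f =>
        (fg k (Contract i)).fullyFaithfulι.preimageIso (β _ ≪≫ f)
    · refine IsZero.of_full_of_faithful_of_isZero (fg k (Contract i)).ι _ ?_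
      exact (isZero_contraction_simple k i).of_iso (β _)
    · exact (contraction_proj k j).map fun f =>
        (fg k (Contract i)).fullyFaithfulι.preimageIso (β _ ≪≫ f)
    · exact (contraction_proj_self k i).map fun f => β _ ≪≫ f
    · exact (contraction_inj k j).map fun f => β _ ≪≫ f
    · exact (contraction_inj_self k i).map fun f => β _ ≪≫ f
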